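/- An operator space is a closed linear subspace $E\subset B(H)$ of the bounded operators on a complex Hilbert space $H$; $M_m(E)$ carries the norm induced by $B(\ell_2^m(H))$, and for a linear map $u\colon E\to F$ between operator spaces $\|u\|_{cb}=\sup_{m\ge 1}\|I_{M_m}\otimes u\|_{M_m(E)\to M_m(F)}$. A linear bijection $u$ is a complete isometry if every $I_{M_m}\otimes u$ is isometric. Put $d_{cb}(E,F)=\inf\{\|u\|_{cb}\|u^{-1}\|_{cb}\}$, the infimum over all linear isomorphisms $u\colon E\to F$ ($=\infty$ if $E$ and $F$ are not completely isomorphic), and $d_{SK}(E)=\inf\{d_{cb}(E,F) : F\subset K(\ell_2)\}$, where $K(\ell_2)$ is the space of compact operators on $\ell_2$. Let $OS_n$ be the set of all $n$-dimensional operator spaces, two of them being identified if they are completely isometric, equipped with the metric $\delta(E,F)=\log d_{cb}(E,F)$. Let $E_0$ be an $n$-dimensional operator space with $d_{SK}(E_0)>1$. Then the subset of $OS_n$ consisting of (the classes of) all $n$-dimensional operator spaces that are linearly isometric, as Banach spaces, to $E_0$ is closed in $OS_n$ but not compact. -/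

import Mathlib

open scoped ENNReal

universe u

set_option maxSynthPendingDepth 3

noncomputable section

namespace OperatorSpace

section Basic

variable {H : Type*} [NormedAddCommGroup H] [InnerProductSpace ℂ H]
variable {K : Type*} [NormedAddCommGroup K] [InnerProductSpace ℂ K]
variable {L : Type*} [NormedAddCommGroup L] [InnerProductSpace ℂ L]

/-- The operator on the Hilbert space `ℓ²_m(H) = H ⊕ ⋯ ⊕ H` given by an `m × m` matrix of
bounded operators on `H`. -/
def blockOp {m : ℕ} (a : Matrix (Fin m) (Fin m) (H →L[ℂ] H)) :
    PiLp 2 (fun _ : Fin m => H) →L[ℂ] PiLp 2 (fun _ : Fin m => H) :=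
  ((PiLp.continuousLinearEquiv 2 ℂ (fun _ : Fin m => H)).symm :
      (Fin m → H) →L[ℂ] PiLp 2 (fun _ : Fin m => H)) ∘L
    (ContinuousLinearMap.pi fun i => ∑ j, (a i j) ∘L ContinuousLinearMap.proj j) ∘L
    ((PiLp.continuousLinearEquiv 2 ℂ (fun _ : Fin m => H)) :
      PiLp 2 (fun _ : Fin m => H) →L[ℂ] (Fin m → H))

/-- The norm of `M_m(E)` for a subspace `E ⊆ B(H)`: the operator norm on `B(ℓ²_m(H))`. -/
def matNorm {E : Submodule ℂ (H →L[ℂ] H)} {m : ℕ} (x : Matrix (Fin m) (Fin m) E) : ℝ :=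
  ‖blockOp (x.map (fun e => (e : H →L[ℂ] H)))‖

/-- The completely bounded norm `‖u‖_cb = sup_m ‖I_{M_m} ⊗ u‖` (possibly `∞`). -/
def cbNorm {E : Submodule ℂ (H →L[ℂ] H)} {F : Submodule ℂ (K →L[ℂ] K)} (u : E →ₗ[ℂ] F) : ℝ≥0∞ :=
  ⨆ (m : ℕ) (x : Matrix (Fin m) (Fin m) E) (_ : matNorm x ≤ 1), ENNReal.ofReal (matNorm (x.map u))

/-- The completely bounded Banach–Mazur distance `d_cb(E, F)`; it is `∞` if `E` and `F` are not
completely isomorphic. -/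
def dcb (E : Submodule ℂ (H →L[ℂ] H)) (F : Submodule ℂ (K →L[ℂ] K)) : ℝ≥0∞ :=
  ⨅ u : E ≃ₗ[ℂ] F, cbNorm (u : E →ₗ[ℂ] F) * cbNorm (u.symm : F →ₗ[ℂ] E)

/-- The linear bijection `u` is a complete isometry. -/
def IsCompleteIsometry {E : Submodule ℂ (H →L[ℂ] H)} {F : Submodule ℂ (K →L[ℂ] K)}
    (u : E ≃ₗ[ℂ] F) : Prop :=
  ∀ (m : ℕ) (x : Matrix (Fin m) (Fin m) E), matNorm (x.map u) = matNorm x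

/-- `d_SK(E)`: the infimum of `d_cb(E, F)` over the subspaces `F` of the space of compact
operators on `ℓ²`. -/
def dSK (E : Submodule ℂ (H →L[ℂ] H)) : ℝ≥0∞ :=
  ⨅ (F : Submodule ℂ (lp (fun _ : ℕ => ℂ) 2 →L[ℂ] lp (fun _ : ℕ => ℂ) 2))
    (_ : ∀ T ∈ F, IsCompactOperator T), dcb E F

/-! ### Elementary facts, needed to see that `log d_cb` is a metric -/

theorem blockOp_apply {m : ℕ} (a : Matrix (Fin m) (Fin m) (H →L[ℂ] H))
    (h : PiLp 2 (fun _ : Fin m => H)) (i : Fin m) : blockOp a h i = ∑ j, a i j (h j) := by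
  simp [blockOp]

theorem blockOp_add {m : ℕ} (a b : Matrix (Fin m) (Fin m) (H →L[ℂ] H)) :
    blockOp (a + b) = blockOp a + blockOp b := by
  ext h i
  simp [blockOp_apply, Finset.sum_add_distrib]

theorem blockOp_smul {m : ℕ} (c : ℂ) (a : Matrix (Fin m) (Fin m) (H →L[ℂ] H)) :
    blockOp (c • a) = c • blockOp a := by
  ext h i
  simp [blockOp_apply, Finset.smul_sum]

variable {E : Submodule ℂ (H →L[ℂ] H)} {F : Submodule ℂ (K →L[ℂ] K)} {G : Submodule ℂ (L →L[ℂ] L)}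

theorem matNorm_nonneg {m : ℕ} (x : Matrix (Fin m) (Fin m) E) : 0 ≤ matNorm x := norm_nonneg _

theorem matNorm_smul {m : ℕ} (c : ℂ) (x : Matrix (Fin m) (Fin m) E) :
    matNorm (c • x) = ‖c‖ * matNorm x := by
  have : (c • x).map (fun e => (e : H →L[ℂ] H)) = c • x.map (fun e => (e : H →L[ℂ] H)) := by
    ext; simp
  rw [matNorm, this, blockOp_smul, norm_smul, matNorm]

theorem matNorm_add_le {m : ℕ} (x y : Matrix (Fin m) (Fin m) E) :
    matNorm (x + y) ≤ matNorm x + matNorm y := by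
  have : (x + y).map (fun e => (e : H →L[ℂ] H)) =
      x.map (fun e => (e : H →L[ℂ] H)) + y.map (fun e => (e : H →L[ℂ] H)) := by
    ext; simp
  rw [matNorm, this, blockOp_add]
  exact norm_add_le _ _

theorem matNorm_sum_le {m : ℕ} {ι : Type*} (s : Finset ι) (x : ι → Matrix (Fin m) (Fin m) E) :
    matNorm (∑ k ∈ s, x k) ≤ ∑ k ∈ s, matNorm (x k) := by
  classical
  induction s using Finset.induction_on with
  | empty => simpa using (matNorm_smul (E := E) (m := m) 0 0).le
  | insert a s ha ih =>
    rw [Finset.sum_insert ha, Finset.sum_insert ha]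
    exact (matNorm_add_le _ _).trans (by gcongr)

theorem norm_entry_le {m : ℕ} (x : Matrix (Fin m) (Fin m) E) (i j : Fin m) :
    ‖x i j‖ ≤ matNorm x := by
  rw [Submodule.coe_norm]
  refine ContinuousLinearMap.opNorm_le_bound _ (matNorm_nonneg x) fun h => ?_
  have h1 := (blockOp (x.map (fun e => (e : H →L[ℂ] H)))).le_opNorm
    (PiLp.single 2 j h)
  have h2 := PiLp.norm_apply_le (blockOp (x.map (fun e => (e : H →L[ℂ] H)))
    (PiLp.single 2 j h)) i
  rw [blockOp_apply, Finset.sum_eq_single j] at h2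
  · simpa using h2.trans (by simpa [matNorm] using h1)
  · intro b _ hb
    simp [hb]
  · simp

theorem matNorm_one (x : Matrix (Fin 1) (Fin 1) E) : matNorm x = ‖x 0 0‖ := by
  refine le_antisymm ?_ (norm_entry_le x 0 0)
  refine ContinuousLinearMap.opNorm_le_bound _ (norm_nonneg _) fun h => ?_
  rw [PiLp.norm_eq_of_L2, PiLp.norm_eq_of_L2]
  simp only [Finset.univ_unique, Finset.sum_singleton, blockOp_apply]
  simp only [Fin.default_eq_zero, Fin.isValue, norm_nonneg, Real.sqrt_sq, Matrix.map_apply]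
  exact (x 0 0 : H →L[ℂ] H).le_opNorm _

theorem cbNorm_le {u : E →ₗ[ℂ] F} {c : ℝ} (hc : 0 ≤ c)
    (h : ∀ (m : ℕ) (x : Matrix (Fin m) (Fin m) E), matNorm (x.map u) ≤ c * matNorm x) :
    cbNorm u ≤ ENNReal.ofReal c := by
  refine iSup_le fun m => iSup_le fun x => iSup_le fun hx => ENNReal.ofReal_le_ofReal ?_
  exact (h m x).trans (by nlinarith)

theorem le_of_cbNorm_le {u : E →ₗ[ℂ] F} {c : ℝ} (hc : 0 ≤ c) (h : cbNorm u ≤ ENNReal.ofReal c)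
    {m : ℕ} (x : Matrix (Fin m) (Fin m) E) : matNorm (x.map u) ≤ c * matNorm x := by
  have key : ∀ y : Matrix (Fin m) (Fin m) E, matNorm y ≤ 1 → matNorm (y.map u) ≤ c := by
    intro y hy
    rw [← ENNReal.ofReal_le_ofReal_iff hc]
    refine le_trans ?_ h
    exact le_iSup_of_le m (le_iSup_of_le y (le_iSup_of_le hy le_rfl))
  have hsmul : ∀ (t : ℝ), 0 ≤ t → matNorm (((t : ℂ) • x).map u) = t * matNorm (x.map u) := by
    intro t ht
    have : ((t : ℂ) • x).map u = (t : ℂ) • x.map u := by ext; simp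
    rw [this, matNorm_smul]
    simp [abs_of_nonneg ht]
  have hsmul' : ∀ (t : ℝ), 0 ≤ t → matNorm ((t : ℂ) • x) = t * matNorm x := by
    intro t ht
    rw [matNorm_smul]
    simp [abs_of_nonneg ht]
  rcases (matNorm_nonneg x).eq_or_lt with h0 | h0
  · have hx : x = 0 := by
      ext1 i j
      have := norm_entry_le x i j
      rw [← h0] at this
      simpa using this
    have : matNorm (x.map u) = 0 * matNorm (x.map u) := by
      rw [← hsmul 0 le_rfl]; simp [hx]
    rw [this, ← h0]; simp
  · have h1 := key (((matNorm x)⁻¹ : ℝ) • x : Matrix (Fin m) (Fin m) E)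
    have h2 := key ((((matNorm x)⁻¹ : ℝ) : ℂ) • x)
      (by rw [hsmul' _ (inv_nonneg.2 h0.le), inv_mul_cancel₀ h0.ne'])
    rw [hsmul _ (inv_nonneg.2 h0.le), inv_mul_le_iff₀ h0] at h2
    linarith [mul_comm c (matNorm x)]

theorem cbNorm_comp_le (v : F →ₗ[ℂ] G) (u : E →ₗ[ℂ] F) (hu : cbNorm u ≠ ⊤) (hv : cbNorm v ≠ ⊤) :
    cbNorm (v ∘ₗ u) ≤ cbNorm v * cbNorm u := by
  rw [← ENNReal.ofReal_toReal hu, ← ENNReal.ofReal_toReal hv,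
    ← ENNReal.ofReal_mul ENNReal.toReal_nonneg]
  refine cbNorm_le (by positivity) fun m x => ?_
  have h1 := le_of_cbNorm_le ENNReal.toReal_nonneg (ENNReal.ofReal_toReal hu).ge x
  have h2 := le_of_cbNorm_le ENNReal.toReal_nonneg (ENNReal.ofReal_toReal hv).ge (x.map u)
  have h3 : x.map (v ∘ₗ u) = (x.map u).map v := by ext; simp
  rw [h3, mul_assoc]
  exact h2.trans (by gcongr)

theorem norm_le_of_cbNorm_le {u : E →ₗ[ℂ] F} {c : ℝ} (hc : 0 ≤ c)
    (h : cbNorm u ≤ ENNReal.ofReal c) (x : E) : ‖u x‖ ≤ c * ‖x‖ := by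
  have := le_of_cbNorm_le hc h (Matrix.of fun _ _ : Fin 1 => x)
  simpa [matNorm_one] using this

/-- A scalar matrix acts on `ℓ²_m(H)` with norm at most that of its action on `ℓ²_m`. -/
theorem sum_norm_sq_le {m : ℕ} (A : Matrix (Fin m) (Fin m) ℂ) (c : ℝ)
    (hA : ∀ v : Fin m → ℂ, ∑ i, ‖∑ j, A i j * v j‖ ^ 2 ≤ c * ∑ j, ‖v j‖ ^ 2) (k : Fin m → H) :
    ∑ i, ‖∑ j, A i j • k j‖ ^ 2 ≤ c * ∑ j, ‖k j‖ ^ 2 := by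
  set S : Submodule ℂ H := Submodule.span ℂ (Set.range k) with hS
  have : FiniteDimensional ℂ S := FiniteDimensional.span_of_finite ℂ (Set.finite_range k)
  let k' : Fin m → S := fun j => ⟨k j, Submodule.subset_span ⟨j, rfl⟩⟩
  let b := stdOrthonormalBasis ℂ S
  have h1 : ∀ i, ‖∑ j, A i j • k j‖ ^ 2 = ∑ l, ‖∑ j, A i j * inner ℂ (b l) (k' j)‖ ^ 2 := by
    intro i
    have h2 : ‖∑ j, A i j • k j‖ = ‖∑ j, A i j • k' j‖ := by
      rw [Submodule.coe_norm]; simp [k']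
    rw [h2, ← b.sum_sq_norm_inner_right]
    simp [inner_sum, inner_smul_right]
  have h3 : ∀ j, ‖k j‖ ^ 2 = ∑ l, ‖inner ℂ (b l) (k' j)‖ ^ 2 := by
    intro j
    have h2 : ‖k j‖ = ‖k' j‖ := rfl
    rw [h2, ← b.sum_sq_norm_inner_right]
  simp_rw [h1, h3]
  rw [Finset.sum_comm, Finset.sum_comm (s := Finset.univ (α := Fin m)), Finset.mul_sum]
  exact Finset.sum_le_sum fun l _ => hA fun j => inner ℂ (b l) (k' j)

/-- The amplification of a bounded functional is bounded by its norm. -/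
theorem functional_amplification_le (φ : E →L[ℂ] ℂ) {m : ℕ} (x : Matrix (Fin m) (Fin m) E)
    (v : Fin m → ℂ) :
    ∑ i, ‖∑ j, φ (x i j) * v j‖ ^ 2 ≤ (‖φ‖ * matNorm x) ^ 2 * ∑ j, ‖v j‖ ^ 2 := by
  set w : Fin m → ℂ := fun i => ∑ j, φ (x i j) * v j with hw
  set z : E := ∑ i, ∑ j, (starRingEnd ℂ (w i) * v j) • x i j with hz
  have hφz : φ z = ((∑ i, ‖w i‖ ^ 2 : ℝ) : ℂ) := by
    simp only [hz, map_sum, map_smul, smul_eq_mul]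
    push_cast
    refine Finset.sum_congr rfl fun i _ => ?_
    rw [← Complex.conj_mul', hw, Finset.mul_sum]
    refine Finset.sum_congr rfl fun j _ => ?_
    ring
  have hV : ∀ (a : Fin m → ℂ) (g : H),
      ‖(WithLp.toLp 2 (fun j => a j • g) : PiLp 2 (fun _ : Fin m => H))‖ =
        √(∑ j, ‖a j‖ ^ 2) * ‖g‖ := by
    intro a g
    rw [PiLp.norm_eq_of_L2]
    simp only [norm_smul, mul_pow]
    rw [← Finset.sum_mul, Real.sqrt_mul (by positivity), Real.sqrt_sq (norm_nonneg _)]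
  have hzn : ‖z‖ ≤ matNorm x * √(∑ j, ‖v j‖ ^ 2) * √(∑ i, ‖w i‖ ^ 2) := by
    rw [Submodule.coe_norm]
    refine ContinuousLinearMap.opNorm_le_bound _
      (mul_nonneg (mul_nonneg (matNorm_nonneg x) (Real.sqrt_nonneg _)) (Real.sqrt_nonneg _))
      fun h => ?_
    set p : PiLp 2 (fun _ : Fin m => H) := WithLp.toLp 2 (fun j => v j • h) with hp
    set T := blockOp (x.map (fun e => (e : H →L[ℂ] H))) with hT
    have e1 : (z : H →L[ℂ] H) h = ∑ i, starRingEnd ℂ (w i) • T p i := by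
      simp [hz, hT, blockOp_apply, hp, Finset.smul_sum, mul_smul]
    rw [e1]
    calc ‖∑ i, starRingEnd ℂ (w i) • T p i‖ ≤ ∑ i, ‖w i‖ * ‖T p i‖ := by
          refine (norm_sum_le _ _).trans (Finset.sum_le_sum fun i _ => ?_)
          rw [norm_smul]; simp
      _ ≤ √(∑ i, ‖w i‖ ^ 2) * √(∑ i, ‖T p i‖ ^ 2) := Real.sum_mul_le_sqrt_mul_sqrt _ _ _
      _ = √(∑ i, ‖w i‖ ^ 2) * ‖T p‖ := by rw [PiLp.norm_eq_of_L2]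
      _ ≤ √(∑ i, ‖w i‖ ^ 2) * (matNorm x * (√(∑ j, ‖v j‖ ^ 2) * ‖h‖)) := by
          rw [← hV]; gcongr; exact T.le_opNorm p
      _ = _ := by ring
  have h0 : 0 ≤ ∑ i, ‖w i‖ ^ 2 := by positivity
  have hle : ∑ i, ‖w i‖ ^ 2 ≤ ‖φ‖ * (matNorm x * √(∑ j, ‖v j‖ ^ 2) * √(∑ i, ‖w i‖ ^ 2)) := by
    calc ∑ i, ‖w i‖ ^ 2 = ‖φ z‖ := by
          rw [hφz, Complex.norm_real, Real.norm_of_nonneg h0]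
      _ ≤ ‖φ‖ * ‖z‖ := φ.le_opNorm z
      _ ≤ _ := by gcongr
  change ∑ i, ‖w i‖ ^ 2 ≤ _
  set s := √(∑ i, ‖w i‖ ^ 2) with hs
  have hs2 : ∑ i, ‖w i‖ ^ 2 = s ^ 2 := (Real.sq_sqrt h0).symm
  have hs0 : 0 ≤ s := Real.sqrt_nonneg _
  have hv : ∑ j, ‖v j‖ ^ 2 = √(∑ j, ‖v j‖ ^ 2) ^ 2 := (Real.sq_sqrt (by positivity)).symm
  rw [hs2] at hle ⊢
  rw [hv, ← mul_pow]
  have hx0 := matNorm_nonneg x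
  refine pow_le_pow_left₀ hs0 ?_ 2
  rcases hs0.eq_or_lt with h | h
  · rw [← h]; positivity
  · refine le_of_mul_le_mul_right ?_ h
    nlinarith

/-- Linear maps on finite-dimensional operator spaces are completely bounded. -/
theorem cbNorm_ne_top [FiniteDimensional ℂ E] (u : E →ₗ[ℂ] F) : cbNorm u ≠ ⊤ := by
  let b := Module.finBasis ℂ E
  let φ : Fin (Module.finrank ℂ E) → (E →L[ℂ] ℂ) := fun k => LinearMap.toContinuousLinearMap (b.coord k)
  have main : ∀ (k) (m : ℕ) (x : Matrix (Fin m) (Fin m) E),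
      matNorm (x.map fun e => φ k e • u (b k)) ≤ (‖φ k‖ * ‖u (b k)‖) * matNorm x := by
    intro k m x
    have hx0 := matNorm_nonneg x
    refine ContinuousLinearMap.opNorm_le_bound _ (by positivity) fun h => ?_
    rw [PiLp.norm_eq_of_L2]
    refine Real.sqrt_le_iff.2 ⟨by positivity, ?_⟩
    have h1 := sum_norm_sq_le (Matrix.of fun i j => φ k (x i j)) _
      (functional_amplification_le (φ k) x) (fun j => (u (b k) : K →L[ℂ] K) (h j))
    have h2 : ∑ j, ‖(u (b k) : K →L[ℂ] K) (h j)‖ ^ 2 ≤ ‖u (b k)‖ ^ 2 * ‖h‖ ^ 2 := by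
      rw [PiLp.norm_sq_eq_of_L2, Finset.mul_sum]
      refine Finset.sum_le_sum fun j _ => ?_
      rw [← mul_pow]
      gcongr
      exact (u (b k) : K →L[ℂ] K).le_opNorm (h j)
    calc _ = ∑ i, ‖∑ j, φ k (x i j) • (u (b k) : K →L[ℂ] K) (h j)‖ ^ 2 := by
          simp [blockOp_apply]
      _ ≤ (‖φ k‖ * matNorm x) ^ 2 * ∑ j, ‖(u (b k) : K →L[ℂ] K) (h j)‖ ^ 2 := h1
      _ ≤ (‖φ k‖ * matNorm x) ^ 2 * (‖u (b k)‖ ^ 2 * ‖h‖ ^ 2) := by gcongr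
      _ = _ := by ring
  refine ne_top_of_le_ne_top ENNReal.ofReal_ne_top
    (cbNorm_le (c := ∑ k, ‖φ k‖ * ‖u (b k)‖) (by positivity) ?_)
  intro m x
  have hsum : x.map u = ∑ k, x.map fun e => φ k e • u (b k) := by
    ext1 i j
    rw [Matrix.sum_apply]
    simp only [Matrix.map_apply]
    conv_lhs => rw [← b.sum_repr (x i j), map_sum]
    refine Finset.sum_congr rfl fun k _ => ?_
    rw [map_smul]
    rfl
  rw [hsum, Finset.sum_mul]
  exact (matNorm_sum_le _ _).trans (Finset.sum_le_sum fun k _ => main k m x)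

theorem cbNorm_le_one {u : E ≃ₗ[ℂ] F} (hu : IsCompleteIsometry u) :
    cbNorm (u : E →ₗ[ℂ] F) ≤ 1 := by
  rw [← ENNReal.ofReal_one]
  exact cbNorm_le zero_le_one fun m x => by rw [one_mul]; exact (hu m x).le

theorem isCompleteIsometry_refl : IsCompleteIsometry (LinearEquiv.refl ℂ E) := fun _ _ => rfl

theorem IsCompleteIsometry.symm {u : E ≃ₗ[ℂ] F} (hu : IsCompleteIsometry u) :
    IsCompleteIsometry u.symm := by
  intro m x
  rw [← hu]
  congr 1
  ext1 i j
  simp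

theorem IsCompleteIsometry.trans {u : E ≃ₗ[ℂ] F} {v : F ≃ₗ[ℂ] G} (hu : IsCompleteIsometry u)
    (hv : IsCompleteIsometry v) : IsCompleteIsometry (u.trans v) := by
  intro m x
  rw [← hu, ← hv]
  rfl

theorem dcb_le_one {u : E ≃ₗ[ℂ] F} (hu : IsCompleteIsometry u) : dcb E F ≤ 1 :=
  (iInf_le _ u).trans (by simpa using mul_le_mul' (cbNorm_le_one hu) (cbNorm_le_one hu.symm))

theorem dcb_comm : dcb E F = dcb F E := by
  refine le_antisymm ?_ ?_ <;>
  · refine le_iInf fun u => (iInf_le _ u.symm).trans ?_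
    rw [mul_comm, LinearEquiv.symm_symm]

theorem dcb_ne_top [FiniteDimensional ℂ E] [FiniteDimensional ℂ F]
    (h : Module.finrank ℂ E = Module.finrank ℂ F) : dcb E F ≠ ⊤ := by
  refine ne_top_of_le_ne_top ?_ (iInf_le _ (LinearEquiv.ofFinrankEq E F h))
  exact ENNReal.mul_ne_top (cbNorm_ne_top _) (cbNorm_ne_top _)

theorem one_le_dcb [FiniteDimensional ℂ E] [Nontrivial E] : 1 ≤ dcb E F := by
  refine le_iInf fun u => ?_
  have : FiniteDimensional ℂ F := u.finiteDimensional
  have h1 : (1 : ℝ≥0∞) ≤ cbNorm ((u.symm : F →ₗ[ℂ] E) ∘ₗ (u : E →ₗ[ℂ] F)) := by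
    obtain ⟨x, hx⟩ := exists_norm_eq E (zero_le_one : (0 : ℝ) ≤ 1)
    refine le_iSup_of_le 1 (le_iSup_of_le (Matrix.of fun _ _ => x) (le_iSup_of_le ?_ ?_))
    · simp [matNorm_one, hx]
    · simp [matNorm_one, hx]
  rw [mul_comm]
  exact h1.trans (cbNorm_comp_le _ _ (cbNorm_ne_top _) (cbNorm_ne_top _))

theorem dcb_triangle [FiniteDimensional ℂ E] [FiniteDimensional ℂ F] [FiniteDimensional ℂ G]
    [Nontrivial E] [Nontrivial F] (h : Module.finrank ℂ E = Module.finrank ℂ F) :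
    dcb E G ≤ dcb E F * dcb F G := by
  have h0 : dcb E F ≠ 0 := (zero_lt_one.trans_le one_le_dcb).ne'
  have h0' : dcb F G ≠ 0 := (zero_lt_one.trans_le one_le_dcb).ne'
  rw [dcb.eq_def F G, ENNReal.mul_iInf_of_ne h0 (dcb_ne_top h)]
  refine le_iInf fun v => ?_
  have : FiniteDimensional ℂ G := v.finiteDimensional
  have hv : (1 : ℝ≥0∞) ≤ cbNorm (v : F →ₗ[ℂ] G) * cbNorm (v.symm : G →ₗ[ℂ] F) :=
    one_le_dcb.trans (iInf_le _ v)
  rw [dcb.eq_def E F, ENNReal.iInf_mul_of_ne (zero_lt_one.trans_le hv).ne'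
    (ENNReal.mul_ne_top (cbNorm_ne_top _) (cbNorm_ne_top _))]
  refine le_iInf fun u => (iInf_le _ (u.trans v)).trans ?_
  have h1 := cbNorm_comp_le (v : F →ₗ[ℂ] G) (u : E →ₗ[ℂ] F) (cbNorm_ne_top _) (cbNorm_ne_top _)
  have h2 := cbNorm_comp_le (u.symm : F →ₗ[ℂ] E) (v.symm : G →ₗ[ℂ] F)
    (cbNorm_ne_top _) (cbNorm_ne_top _)
  refine (mul_le_mul' h1 h2).trans (le_of_eq ?_)
  ring

theorem continuous_matNorm_map [FiniteDimensional ℂ E] [FiniteDimensional ℂ F] {m : ℕ}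
    (x : Matrix (Fin m) (Fin m) E) : Continuous fun u : E →L[ℂ] F => matNorm (x.map u) := by
  let Φ : (E →L[ℂ] F) →ₗ[ℂ] (PiLp 2 (fun _ : Fin m => K) →L[ℂ] PiLp 2 (fun _ : Fin m => K)) :=
    { toFun := fun u => blockOp ((x.map u).map (fun e => (e : K →L[ℂ] K)))
      map_add' := fun u v => by
        rw [← blockOp_add]; congr 1
      map_smul' := fun c u => by
        rw [RingHom.id_apply, ← blockOp_smul]; congr 1 }
  exact Φ.continuous_of_finiteDimensional.norm

/-- Bounded sequences of mutually inverse maps between finite-dimensional normed spaces subconverge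
to mutually inverse maps. -/
theorem exists_limit_inverse_pair {V W : Type*} [NormedAddCommGroup V] [NormedSpace ℂ V]
    [NormedAddCommGroup W] [NormedSpace ℂ W] [FiniteDimensional ℂ V] [FiniteDimensional ℂ W]
    (a : ℕ → (V →L[ℂ] W)) (b : ℕ → (W →L[ℂ] V)) (hba : ∀ k x, b k (a k x) = x)
    (hab : ∀ k y, a k (b k y) = y) (hna : ∀ k, ‖a k‖ ≤ 1) (hnb : ∀ k, ‖b k‖ ≤ 2) :
    ∃ (A : V →L[ℂ] W) (B : W →L[ℂ] V) (φ : ℕ → ℕ), StrictMono φ ∧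
      Filter.Tendsto (fun k => a (φ k)) Filter.atTop (nhds A) ∧
      Filter.Tendsto (fun k => b (φ k)) Filter.atTop (nhds B) ∧
      (∀ x, B (A x) = x) ∧ (∀ y, A (B y) = y) := by
  have hcomp : IsCompact ((Metric.closedBall (0 : V →L[ℂ] W) 1) ×ˢ
      (Metric.closedBall (0 : W →L[ℂ] V) 2)) := by
    have : ProperSpace (V →L[ℂ] W) := FiniteDimensional.proper ℂ _
    have : ProperSpace (W →L[ℂ] V) := FiniteDimensional.proper ℂ _
    exact (isCompact_closedBall _ _).prod (isCompact_closedBall _ _)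
  obtain ⟨⟨A, B⟩, -, φ, hφ, hlim⟩ := hcomp.tendsto_subseq (x := fun k => (a k, b k))
    (fun k => ⟨by simpa using hna k, by simpa using hnb k⟩)
  rw [Prod.tendsto_iff] at hlim
  obtain ⟨hA, hB⟩ := hlim
  simp only [Function.comp_def] at hA hB
  refine ⟨A, B, φ, hφ, hA, hB, fun x => ?_, fun y => ?_⟩
  · have h1 : Filter.Tendsto (fun k => b (φ k) (a (φ k) x)) Filter.atTop (nhds (B (A x))) :=
      (isBoundedBilinearMap_apply.continuous.tendsto (B, A x)).comp (hB.prodMk_nhds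
        ((isBoundedBilinearMap_apply.continuous.tendsto (A, x)).comp
          (hA.prodMk_nhds tendsto_const_nhds)))
    simp only [hba] at h1
    exact tendsto_nhds_unique h1 tendsto_const_nhds
  · have h1 : Filter.Tendsto (fun k => a (φ k) (b (φ k) y)) Filter.atTop (nhds (A (B y))) :=
      (isBoundedBilinearMap_apply.continuous.tendsto (A, B y)).comp (hA.prodMk_nhds
        ((isBoundedBilinearMap_apply.continuous.tendsto (B, y)).comp
          (hB.prodMk_nhds tendsto_const_nhds)))
    simp only [hab] at h1
    exact tendsto_nhds_unique h1 tendsto_const_nhds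

/-- Finite-dimensional spaces at `d_cb`-distance one are completely isometric. -/
theorem exists_isCompleteIsometry [FiniteDimensional ℂ E] [FiniteDimensional ℂ F] [Nontrivial E]
    (h : dcb E F ≤ 1) : ∃ u : E ≃ₗ[ℂ] F, IsCompleteIsometry u := by
  have key : ∀ k : ℕ, ∃ (a : E →L[ℂ] F) (b : F →L[ℂ] E),
      (∀ x, b (a x) = x) ∧ (∀ y, a (b y) = y) ∧
      (∀ (m : ℕ) (x : Matrix (Fin m) (Fin m) E), matNorm (x.map a) ≤ matNorm x) ∧
      (∀ (m : ℕ) (y : Matrix (Fin m) (Fin m) F),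
        matNorm (y.map b) ≤ (1 + 1 / ((k : ℝ) + 1)) * matNorm y) ∧
      ‖a‖ ≤ 1 ∧ ‖b‖ ≤ 2 := by
    intro k
    have hk : (0 : ℝ) < 1 / ((k : ℝ) + 1) := by positivity
    have hlt : dcb E F < ENNReal.ofReal (1 + 1 / ((k : ℝ) + 1)) := by
      refine h.trans_lt ?_
      rw [← ENNReal.ofReal_one, ENNReal.ofReal_lt_ofReal_iff (by positivity)]
      linarith
    obtain ⟨u, hu⟩ := iInf_lt_iff.1 hlt
    have h1 : (1 : ℝ≥0∞) ≤ cbNorm (u : E →ₗ[ℂ] F) * cbNorm (u.symm : F →ₗ[ℂ] E) :=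
      one_le_dcb.trans (iInf_le _ u)
    set s := (cbNorm (u : E →ₗ[ℂ] F)).toReal with hs
    set t := (cbNorm (u.symm : F →ₗ[ℂ] E)).toReal with ht
    have hs' := ENNReal.ofReal_toReal (cbNorm_ne_top (u : E →ₗ[ℂ] F))
    have ht' := ENNReal.ofReal_toReal (cbNorm_ne_top (u.symm : F →ₗ[ℂ] E))
    rw [← hs'] at h1 hu
    rw [← ht', ← ENNReal.ofReal_mul ENNReal.toReal_nonneg] at h1 hu
    have hst : s * t ≤ 1 + 1 / ((k : ℝ) + 1) :=
      (ENNReal.ofReal_le_ofReal_iff (by positivity)).1 hu.le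
    have hst1 : 1 ≤ s * t := by
      rw [← ENNReal.ofReal_one] at h1
      exact (ENNReal.ofReal_le_ofReal_iff (by positivity)).1 h1
    have ht0 : 0 ≤ t := ENNReal.toReal_nonneg
    have hs0 : 0 < s := by
      have : 0 ≤ s := ENNReal.toReal_nonneg
      rcases this.eq_or_lt with h | h
      · rw [← h] at hst1; norm_num at hst1
      · exact h
    have ha : ∀ (m : ℕ) (x : Matrix (Fin m) (Fin m) E),
        matNorm (x.map fun e => ((s⁻¹ : ℝ) : ℂ) • u e) ≤ matNorm x := by
      intro m x
      have e : (x.map fun e => ((s⁻¹ : ℝ) : ℂ) • u e) = ((s⁻¹ : ℝ) : ℂ) • x.map u := by ext; simp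
      rw [e, matNorm_smul, Complex.norm_real, Real.norm_of_nonneg (by positivity),
        inv_mul_le_iff₀ hs0]
      exact le_of_cbNorm_le hs0.le hs'.ge x
    have hb : ∀ (m : ℕ) (y : Matrix (Fin m) (Fin m) F),
        matNorm (y.map fun e => (s : ℂ) • u.symm e) ≤ (1 + 1 / ((k : ℝ) + 1)) * matNorm y := by
      intro m y
      have e : (y.map fun e => (s : ℂ) • u.symm e) = (s : ℂ) • y.map u.symm := by ext; simp
      rw [e, matNorm_smul, Complex.norm_real, Real.norm_of_nonneg hs0.le]
      have h2 : matNorm (y.map u.symm) ≤ t * matNorm y := le_of_cbNorm_le ht0 ht'.ge y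
      calc s * matNorm (y.map u.symm) ≤ s * (t * matNorm y) := by gcongr
        _ = (s * t) * matNorm y := by ring
        _ ≤ _ := mul_le_mul_of_nonneg_right hst (matNorm_nonneg y)
    have hsC : (s : ℂ) ≠ 0 := by exact_mod_cast hs0.ne'
    refine ⟨LinearMap.toContinuousLinearMap (((s⁻¹ : ℝ) : ℂ) • (u : E →ₗ[ℂ] F)),
      LinearMap.toContinuousLinearMap ((s : ℂ) • (u.symm : F →ₗ[ℂ] E)), ?_, ?_, ha, hb, ?_, ?_⟩
    · intro x
      change (s : ℂ) • u.symm (((s⁻¹ : ℝ) : ℂ) • u x) = x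
      rw [map_smul, smul_smul, LinearEquiv.symm_apply_apply, Complex.ofReal_inv,
        mul_inv_cancel₀ hsC, one_smul]
    · intro y
      change ((s⁻¹ : ℝ) : ℂ) • u ((s : ℂ) • u.symm y) = y
      rw [map_smul, smul_smul, LinearEquiv.apply_symm_apply, Complex.ofReal_inv,
        inv_mul_cancel₀ hsC, one_smul]
    · refine ContinuousLinearMap.opNorm_le_bound _ zero_le_one fun x => ?_
      have := ha 1 (Matrix.of fun _ _ => x)
      rw [matNorm_one, matNorm_one] at this
      rw [one_mul]
      exact this
    · refine ContinuousLinearMap.opNorm_le_bound _ zero_le_two fun y => ?_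
      have := hb 1 (Matrix.of fun _ _ => y)
      rw [matNorm_one, matNorm_one] at this
      refine le_trans this (mul_le_mul_of_nonneg_right ?_ (norm_nonneg y))
      have : 1 / ((k : ℝ) + 1) ≤ 1 := by
        rw [div_le_one (by positivity)]
        linarith [(Nat.cast_nonneg k : (0 : ℝ) ≤ k)]
      linarith
  choose a b hba hab ha hb hna hnb using key
  obtain ⟨A, B, φ, hφ, hA, hB, hBA, hAB⟩ := exists_limit_inverse_pair a b hba hab hna hnb
  have hA1 : ∀ (m : ℕ) (x : Matrix (Fin m) (Fin m) E), matNorm (x.map A) ≤ matNorm x :=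
    fun m x => le_of_tendsto' (((continuous_matNorm_map x).tendsto A).comp hA) fun k => ha _ m x
  have hB1 : ∀ (m : ℕ) (y : Matrix (Fin m) (Fin m) F), matNorm (y.map B) ≤ matNorm y := by
    intro m y
    have hε : Filter.Tendsto (fun k : ℕ => (1 + 1 / (((φ k : ℕ) : ℝ) + 1)) * matNorm y)
        Filter.atTop (nhds ((1 + 0) * matNorm y)) :=
      ((tendsto_one_div_add_atTop_nhds_zero_nat.comp hφ.tendsto_atTop).const_add 1).mul_const _
    rw [add_zero, one_mul] at hε
    exact le_of_tendsto_of_tendsto' (((continuous_matNorm_map y).tendsto B).comp hB) hε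
      fun k => hb _ m y
  refine ⟨LinearEquiv.ofLinearMap (A : E →ₗ[ℂ] F) (B : F →ₗ[ℂ] E) (LinearMap.ext hAB)
    (LinearMap.ext hBA), fun m x => le_antisymm (hA1 m x) ?_⟩
  have := hB1 m (x.map A)
  have e : (x.map A).map B = x := by ext1 i j; simp [hBA]
  rwa [e] at this

end Basic

/-- An `n`-dimensional operator space: an `n`-dimensional subspace `E ⊆ B(H)` (automatically
closed), where `H` is a complex Hilbert space. -/
structure FinDim (n : ℕ) where
  /-- the Hilbert space -/
  H : Type u
  [normed : NormedAddCommGroup H]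
  [inner : InnerProductSpace ℂ H]
  [complete : CompleteSpace H]
  /-- the subspace of `B(H)` -/
  E : Submodule ℂ (H →L[ℂ] H)
  finiteDimensional : FiniteDimensional ℂ E
  finrank_eq : Module.finrank ℂ E = n

attribute [instance] FinDim.normed FinDim.inner FinDim.complete FinDim.finiteDimensional

/-- Complete isometry as an equivalence relation on `n`-dimensional operator spaces. -/
instance FinDim.setoid (n : ℕ) : Setoid (FinDim.{u} n) where
  r X Y := ∃ u : X.E ≃ₗ[ℂ] Y.E, IsCompleteIsometry u
  iseqv :=
    { refl := fun _ => ⟨_, isCompleteIsometry_refl⟩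
      symm := fun ⟨_, hu⟩ => ⟨_, hu.symm⟩
      trans := fun ⟨_, hu⟩ ⟨_, hv⟩ => ⟨_, hu.trans hv⟩ }

/-- `OS_n`: the `n`-dimensional operator spaces up to complete isometry. -/
def OS (n : ℕ) : Type (u + 1) := Quotient (FinDim.setoid.{u} n)

/-- The class in `OS_n` of an `n`-dimensional operator space. -/
def OS.mk {n : ℕ} (X : FinDim.{u} n) : OS.{u} n := Quotient.mk _ X

theorem FinDim.nontrivial {n : ℕ} (hn : n ≠ 0) (X : FinDim.{u} n) : Nontrivial X.E :=
  Module.nontrivial_of_finrank_pos (R := ℂ) (by rw [X.finrank_eq]; omega)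

theorem FinDim.dcb_triangle {n : ℕ} (hn : n ≠ 0) (X Y Z : FinDim.{u} n) :
    dcb X.E Z.E ≤ dcb X.E Y.E * dcb Y.E Z.E := by
  have := X.nontrivial hn
  have := Y.nontrivial hn
  exact OperatorSpace.dcb_triangle (by rw [X.finrank_eq, Y.finrank_eq])

theorem FinDim.dcb_ne_top {n : ℕ} (X Y : FinDim.{u} n) : dcb X.E Y.E ≠ ⊤ :=
  OperatorSpace.dcb_ne_top (by rw [X.finrank_eq, Y.finrank_eq])

theorem FinDim.equiv_of_dim_zero (X Y : FinDim.{u} 0) : X ≈ Y := by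
  have hX := Module.finrank_zero_iff.1 X.finrank_eq
  have hY := Module.finrank_zero_iff.1 Y.finrank_eq
  refine ⟨LinearEquiv.ofFinrankEq _ _ (by rw [X.finrank_eq, Y.finrank_eq]), fun m x => ?_⟩
  have h1 : x = (0 : ℂ) • x := by ext1 i j; exact Subsingleton.elim _ _
  rw [h1, matNorm_smul]
  have h2 : ((0 : ℂ) • x).map (LinearEquiv.ofFinrankEq X.E Y.E
      (by rw [X.finrank_eq, Y.finrank_eq])) = (0 : ℂ) • (0 : Matrix (Fin m) (Fin m) Y.E) := by
    ext1 i j; exact Subsingleton.elim _ _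
  rw [h2, matNorm_smul]
  simp

theorem FinDim.dcb_dim_zero (X Y : FinDim.{u} 0) : dcb X.E Y.E = 0 := by
  have hY := Module.finrank_zero_iff.1 Y.finrank_eq
  let w : X.E ≃ₗ[ℂ] Y.E := LinearEquiv.ofFinrankEq _ _ (by rw [X.finrank_eq, Y.finrank_eq])
  have h0 : cbNorm (w : X.E →ₗ[ℂ] Y.E) ≤ ENNReal.ofReal 0 := by
    refine cbNorm_le le_rfl fun m x => ?_
    have h2 : x.map (w : X.E →ₗ[ℂ] Y.E) = (0 : ℂ) • (0 : Matrix (Fin m) (Fin m) Y.E) := by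
      ext1 i j; exact Subsingleton.elim _ _
    rw [h2, matNorm_smul]
    simp
  rw [ENNReal.ofReal_zero, nonpos_iff_eq_zero] at h0
  refine nonpos_iff_eq_zero.1 ((iInf_le _ w).trans ?_)
  rw [h0, zero_mul]

/-- `d_cb` as a function on `OS_n × OS_n`. -/
def OS.dcb {n : ℕ} (X Y : OS.{u} n) : ℝ≥0∞ :=
  Quotient.liftOn₂ X Y (fun X Y => OperatorSpace.dcb X.E Y.E) (by
    have aux : ∀ X Y X' Y' : FinDim.{u} n, X ≈ X' → Y ≈ Y' →
        OperatorSpace.dcb X.E Y.E ≤ OperatorSpace.dcb X'.E Y'.E := by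
      rintro X Y X' Y' ⟨f, hf⟩ ⟨g, hg⟩
      rcases eq_or_ne n 0 with rfl | hn
      · simp [FinDim.dcb_dim_zero]
      · calc _ ≤ OperatorSpace.dcb X.E X'.E * OperatorSpace.dcb X'.E Y.E :=
              FinDim.dcb_triangle hn _ _ _
          _ ≤ OperatorSpace.dcb X.E X'.E *
                (OperatorSpace.dcb X'.E Y'.E * OperatorSpace.dcb Y'.E Y.E) := by
              gcongr; exact FinDim.dcb_triangle hn _ _ _
          _ ≤ 1 * (OperatorSpace.dcb X'.E Y'.E * 1) := by
              gcongr
              · exact dcb_le_one hf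
              · exact dcb_le_one hg.symm
          _ = _ := by ring
    exact fun X Y X' Y' h h' => le_antisymm (aux _ _ _ _ h h')
      (aux _ _ _ _ (Setoid.symm h) (Setoid.symm h')))

/-- `OS_n` is a metric space with the distance `δ(E, F) = log d_cb(E, F)`. -/
instance OS.metricSpace (n : ℕ) : MetricSpace (OS.{u} n) where
  dist X Y := Real.log (OS.dcb X Y).toReal
  dist_self X := by
    induction X using Quotient.inductionOn with | h X => ?_
    have h1 : OperatorSpace.dcb X.E X.E ≤ 1 := dcb_le_one isCompleteIsometry_refl
    change Real.log (OperatorSpace.dcb X.E X.E).toReal = 0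
    rcases eq_or_ne n 0 with rfl | hn
    · simp [FinDim.dcb_dim_zero]
    · have := X.nontrivial hn
      rw [le_antisymm h1 one_le_dcb]
      simp
  dist_comm X Y := by
    induction X using Quotient.inductionOn with | h X => ?_
    induction Y using Quotient.inductionOn with | h Y => ?_
    change Real.log (OperatorSpace.dcb X.E Y.E).toReal = Real.log (OperatorSpace.dcb Y.E X.E).toReal
    rw [dcb_comm]
  dist_triangle X Y Z := by
    induction X using Quotient.inductionOn with | h X => ?_
    induction Y using Quotient.inductionOn with | h Y => ?_
    induction Z using Quotient.inductionOn with | h Z => ?_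
    change Real.log (OperatorSpace.dcb X.E Z.E).toReal ≤
      Real.log (OperatorSpace.dcb X.E Y.E).toReal + Real.log (OperatorSpace.dcb Y.E Z.E).toReal
    rcases eq_or_ne n 0 with rfl | hn
    · simp [FinDim.dcb_dim_zero]
    · have := X.nontrivial hn
      have := Y.nontrivial hn
      have pos : ∀ V W : FinDim.{u} n, 0 < (OperatorSpace.dcb V.E W.E).toReal := fun V W => by
        have := V.nontrivial hn
        exact ENNReal.toReal_pos (zero_lt_one.trans_le one_le_dcb).ne' (FinDim.dcb_ne_top V W)
      rw [← Real.log_mul (pos _ _).ne' (pos _ _).ne', ← ENNReal.toReal_mul]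
      exact Real.log_le_log (pos _ _) (ENNReal.toReal_mono
        (ENNReal.mul_ne_top (FinDim.dcb_ne_top _ _) (FinDim.dcb_ne_top _ _))
        (FinDim.dcb_triangle hn _ _ _))
  eq_of_dist_eq_zero {X Y} h := by
    induction X using Quotient.inductionOn with | h X => ?_
    induction Y using Quotient.inductionOn with | h Y => ?_
    change Real.log (OperatorSpace.dcb X.E Y.E).toReal = 0 at h
    refine Quotient.sound ?_
    rcases eq_or_ne n 0 with rfl | hn
    · exact FinDim.equiv_of_dim_zero X Y
    · have := X.nontrivial hn
      refine exists_isCompleteIsometry ?_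
      have h1 : (1 : ℝ≥0∞) ≤ OperatorSpace.dcb X.E Y.E := one_le_dcb
      have ht := FinDim.dcb_ne_top X Y
      have h2 : (1 : ℝ) ≤ (OperatorSpace.dcb X.E Y.E).toReal := by
        simpa using ENNReal.toReal_mono ht h1
      rw [← ENNReal.ofReal_toReal ht, Real.eq_one_of_pos_of_log_eq_zero (by linarith) h]
      simp

/-- The subset of `OS_n` formed of (the classes of) all `n`-dimensional operator spaces which are
linearly isometric, as Banach spaces, to `E₀`. -/
def OS.isometricTo {n : ℕ} (E₀ : FinDim.{u} n) : Set (OS.{u} n) :=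
  {X | ∃ F : FinDim.{u} n, OS.mk F = X ∧ Nonempty (F.E ≃ₗᵢ[ℂ] E₀.E)}

end OperatorSpace

end

/-! Closedness is a compactness argument. If spaces isometric to `E` approach `X` in `OS n`,
rescaled isomorphisms give maps `X → E` that are contractive with inverses of norm at most `1 +
1/(k+1)`. In finite dimension such maps subconverge, with their inverses, to an isometry
(`exists_limit_equiv`, used at level one).

Non-compactness comes from one sequence in the isometry class that cannot subconverge when `d_SK(E)
> 1`. For finite-dimensional `K`, renorm `E` by the direct sum `kMinRep` of all complete
contractions `E → B(K)`. Two facts carry the argument. (1) The new matrix norms agree with the old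
ones at every level `m` with `2 * m ≤ dim K` (`ampNorm_kMinRep`): to test the norm of a matrix at
`m` vectors, only these vectors and their `m` images matter, and they fit in a subspace of dimension
at most `2 * m`. In particular the new space is isometric to `E` once `dim K ≥ 2`. (2) The new space
has `d_SK ≤ 1` (`dSK_kMinRep_le_one`): complete contractions form a bounded set in a
finite-dimensional space, so finitely many give the norm up to `1 + ε`, and their direct sum acts on
a finite-dimensional Hilbert space.

Let `dim K → ∞`. If the isometry class were compact, a subsequence would converge to some `X`. By
(2) and `dSK_le_mul`, `d_SK(X) ≤ 1`. By (1) every fixed matrix level eventually sees only the norms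
of `E`, so a limit of almost isometric maps is a complete isometry `X → E`. Hence `d_SK(E) ≤ 1`, a
contradiction. -/

noncomputable section

namespace OperatorSpace

section Amplification

variable {H : Type*} [NormedAddCommGroup H] [InnerProductSpace ℂ H]
variable {K : Type*} [NormedAddCommGroup K] [InnerProductSpace ℂ K]

/-! ### Amplifications of operator-valued linear maps -/

/-- The norm of the amplification `I_{M_m} ⊗ T` of an operator-valued linear map at `x`. -/
def ampNorm {V : Type*} [AddCommGroup V] [Module ℂ V] (T : V →ₗ[ℂ] (H →L[ℂ] H)) {m : ℕ}
    (x : Matrix (Fin m) (Fin m) V) : ℝ :=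
  ‖blockOp (x.map T)‖

section Amp

variable {V : Type*} [AddCommGroup V] [Module ℂ V]

theorem ampNorm_nonneg (T : V →ₗ[ℂ] (H →L[ℂ] H)) {m : ℕ} (x : Matrix (Fin m) (Fin m) V) :
    0 ≤ ampNorm T x := norm_nonneg _

theorem ampNorm_le_of_forall (T : V →ₗ[ℂ] (H →L[ℂ] H)) {m : ℕ} (x : Matrix (Fin m) (Fin m) V)
    {c : ℝ} (hc : 0 ≤ c)
    (h : ∀ v : Fin m → H, ∑ i, ‖∑ j, T (x i j) (v j)‖ ^ 2 ≤ c ^ 2 * ∑ j, ‖v j‖ ^ 2) :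
    ampNorm T x ≤ c := by
  refine ContinuousLinearMap.opNorm_le_bound _ hc fun v => ?_
  rw [← abs_of_nonneg (norm_nonneg (blockOp (x.map T) v)), ← abs_of_nonneg hc,
    ← abs_of_nonneg (norm_nonneg v), ← abs_mul, ← sq_le_sq, mul_pow,
    PiLp.norm_sq_eq_of_L2, PiLp.norm_sq_eq_of_L2]
  simpa only [blockOp_apply, Matrix.map_apply] using h v

theorem sum_norm_sq_le_ampNorm (T : V →ₗ[ℂ] (H →L[ℂ] H)) {m : ℕ} (x : Matrix (Fin m) (Fin m) V)
    (v : Fin m → H) :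
    ∑ i, ‖∑ j, T (x i j) (v j)‖ ^ 2 ≤ ampNorm T x ^ 2 * ∑ j, ‖v j‖ ^ 2 := by
  have h := (blockOp (x.map T)).le_opNorm (WithLp.toLp 2 v)
  have h2 := pow_le_pow_left₀ (norm_nonneg _) h 2
  rw [mul_pow, PiLp.norm_sq_eq_of_L2, PiLp.norm_sq_eq_of_L2] at h2
  simp only [blockOp_apply, Matrix.map_apply] at h2
  exact h2

theorem ampNorm_sub_le (S T : V →ₗ[ℂ] (H →L[ℂ] H)) {m : ℕ} (x : Matrix (Fin m) (Fin m) V) :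
    ampNorm S x ≤ ampNorm T x + ampNorm (S - T) x := by
  have e : x.map S = x.map T + x.map (S - T) := by ext1 i j; simp
  rw [ampNorm, e, blockOp_add]
  exact norm_add_le _ _

theorem ampNorm_coe_sub_le {W : Type*} [SeminormedAddCommGroup W] [NormedSpace ℂ W]
    (S T : W →L[ℂ] (H →L[ℂ] H)) {m : ℕ} (x : Matrix (Fin m) (Fin m) W) :
    ampNorm (S : W →ₗ[ℂ] (H →L[ℂ] H)) x ≤
      ampNorm (T : W →ₗ[ℂ] (H →L[ℂ] H)) x + ampNorm ((S - T : W →L[ℂ] _) : W →ₗ[ℂ] (H →L[ℂ] H)) x :=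
  ampNorm_sub_le (S : W →ₗ[ℂ] (H →L[ℂ] H)) (T : W →ₗ[ℂ] (H →L[ℂ] H)) x

/-- Compression by contractions does not increase amplified norms. -/
theorem ampNorm_le_of_compress (T : V →ₗ[ℂ] (H →L[ℂ] H)) (S : V →ₗ[ℂ] (K →L[ℂ] K))
    (A : H →L[ℂ] K) (B : K →L[ℂ] H) (hA : ‖A‖ ≤ 1) (hB : ‖B‖ ≤ 1)
    (h : ∀ v k, S v k = A (T v (B k))) {m : ℕ} (x : Matrix (Fin m) (Fin m) V) :
    ampNorm S x ≤ ampNorm T x := by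
  refine ampNorm_le_of_forall S x (ampNorm_nonneg T x) fun v => ?_
  calc ∑ i, ‖∑ j, S (x i j) (v j)‖ ^ 2 ≤ ∑ i, ‖∑ j, T (x i j) (B (v j))‖ ^ 2 := by
        refine Finset.sum_le_sum fun i _ => pow_le_pow_left₀ (norm_nonneg _) ?_ 2
        simp only [h, ← map_sum]
        exact A.le_of_opNorm_le hA _ |>.trans_eq (one_mul _)
    _ ≤ ampNorm T x ^ 2 * ∑ j, ‖B (v j)‖ ^ 2 := sum_norm_sq_le_ampNorm T x _
    _ ≤ _ := by
        gcongr with j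
        exact B.le_of_opNorm_le hB _ |>.trans_eq (one_mul _)

theorem ampNorm_one (T : V →ₗ[ℂ] (H →L[ℂ] H)) (v : V) :
    ampNorm T (Matrix.of fun _ _ : Fin 1 => v) = ‖T v‖ := by
  have hw : ∀ g : H, T v g = ∑ _j : Fin 1, T v g := by simp
  refine le_antisymm (ampNorm_le_of_forall _ _ (norm_nonneg _) fun w => ?_)
    (ContinuousLinearMap.opNorm_le_bound _ (ampNorm_nonneg _ _) fun g => ?_)
  · simpa [mul_pow] using pow_le_pow_left₀ (norm_nonneg _) ((T v).le_opNorm (w 0)) 2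
  · have := sum_norm_sq_le_ampNorm T (Matrix.of fun _ _ : Fin 1 => v) (fun _ => g)
    simp only [Finset.univ_unique, Finset.sum_singleton, Matrix.of_apply] at this
    rw [← mul_pow] at this
    exact le_of_sq_le_sq this (mul_nonneg (ampNorm_nonneg _ _) (norm_nonneg _))

theorem ampNorm_comp {W : Type*} [AddCommGroup W] [Module ℂ W] (T : V →ₗ[ℂ] (H →L[ℂ] H))
    (e : W →ₗ[ℂ] V) {m : ℕ} (x : Matrix (Fin m) (Fin m) W) :
    ampNorm (T ∘ₗ e) x = ampNorm T (x.map e) := rfl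

theorem matNorm_eq_ampNorm (E : Submodule ℂ (H →L[ℂ] H)) {m : ℕ} (x : Matrix (Fin m) (Fin m) E) :
    matNorm x = ampNorm E.subtype x := rfl

/-- The isomorphism of an injective representation onto its range carries amplified norms to
matrix norms. -/
theorem matNorm_map_ofInjective (T : V →ₗ[ℂ] (H →L[ℂ] H)) (hT : Function.Injective T) {m : ℕ}
    (x : Matrix (Fin m) (Fin m) V) :
    matNorm (x.map (LinearEquiv.ofInjective T hT)) = ampNorm T x := by
  rw [matNorm, ampNorm]
  congr 1

theorem matNorm_eq_ampNorm_symm (T : V →ₗ[ℂ] (H →L[ℂ] H)) (hT : Function.Injective T) {m : ℕ}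
    (y : Matrix (Fin m) (Fin m) (LinearMap.range T)) :
    matNorm y = ampNorm T (y.map (LinearEquiv.ofInjective T hT).symm) := by
  rw [← matNorm_map_ofInjective T hT]
  congr 1
  ext1 i j
  exact ((LinearEquiv.ofInjective T hT).apply_symm_apply _).symm

end Amp

/-! ### Direct sums of representations -/

section DirectSum

variable {V : Type*} [SeminormedAddCommGroup V] [NormedSpace ℂ V] {ι : Type*}

theorem memℓp_directSum (S : ι → (V →L[ℂ] (H →L[ℂ] H))) (hS : ∀ i, ‖S i‖ ≤ 1) (v : V)
    (f : lp (fun _ : ι => H) 2) : Memℓp (fun i => S i v (f i)) 2 := by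
  refine memℓp_gen ?_
  have hf := ((lp.memℓp f).summable (by norm_num)).mul_left (‖v‖ ^ 2)
  refine Summable.of_nonneg_of_le (fun i => by positivity) (fun i => ?_) hf
  simp only [ENNReal.toReal_ofNat, Real.rpow_ofNat]
  rw [← mul_pow]
  gcongr
  refine ((S i v).le_opNorm _).trans ?_
  gcongr
  exact ((S i).le_of_opNorm_le (hS i) v).trans_eq (one_mul _)

theorem lp_norm_sq {G : Type*} [NormedAddCommGroup G] (f : lp (fun _ : ι => G) 2) :
    HasSum (fun i => ‖f i‖ ^ 2) (‖f‖ ^ 2) := by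
  simpa using lp.hasSum_norm (p := 2) (by norm_num) f

/-- The direct sum of a family of contractive representations. -/
def directSumRep (S : ι → (V →L[ℂ] (H →L[ℂ] H))) (hS : ∀ i, ‖S i‖ ≤ 1) :
    V →ₗ[ℂ] (lp (fun _ : ι => H) 2 →L[ℂ] lp (fun _ : ι => H) 2) where
  toFun v := LinearMap.mkContinuous
    { toFun := fun f => ⟨fun i => S i v (f i), memℓp_directSum S hS v f⟩
      map_add' := fun f g => by ext i; exact map_add (S i v) _ _
      map_smul' := fun c f => by ext i; simp } ‖v‖ (fun f => by
        rw [← abs_of_nonneg (norm_nonneg f), ← abs_of_nonneg (norm_nonneg v), ← abs_mul]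
        refine (le_abs_self _).trans (sq_le_sq.1 ?_)
        rw [mul_pow]
        refine hasSum_le (fun i => ?_) (lp_norm_sq _) ((lp_norm_sq f).mul_left _)
        rw [← mul_pow]
        refine pow_le_pow_left₀ (norm_nonneg _) (((S i v).le_opNorm _).trans ?_) 2
        gcongr
        exact ((S i).le_of_opNorm_le (hS i) v).trans_eq (one_mul _))
  map_add' v w := by ext f i; simp; rfl
  map_smul' c v := by ext f i; simp

theorem directSumRep_apply (S : ι → (V →L[ℂ] (H →L[ℂ] H))) (hS : ∀ i, ‖S i‖ ≤ 1) (v : V)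
    (f : lp (fun _ : ι => H) 2) (i : ι) : directSumRep S hS v f i = S i v (f i) := rfl

/-- Each summand is a compression of the sum, by the coordinate projection and the coordinate
inclusion. -/
theorem ampNorm_le_directSumRep (S : ι → (V →L[ℂ] (H →L[ℂ] H))) (hS : ∀ i, ‖S i‖ ≤ 1) (i : ι)
    {m : ℕ} (x : Matrix (Fin m) (Fin m) V) :
    ampNorm (S i : V →ₗ[ℂ] (H →L[ℂ] H)) x ≤ ampNorm (directSumRep S hS) x := by
  classical
  refine ampNorm_le_of_compress _ _
    (LinearMap.mkContinuous
      { toFun := fun f : lp (fun _ : ι => H) 2 => f i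
        map_add' := fun _ _ => rfl
        map_smul' := fun _ _ => rfl } 1 (fun f => by
          rw [one_mul]; exact lp.norm_apply_le_norm (by norm_num) f i))
    (lp.singleContinuousLinearMap ℂ (fun _ : ι => H) 2 i)
    (LinearMap.mkContinuous_norm_le _ zero_le_one _)
    (ContinuousLinearMap.opNorm_le_bound _ zero_le_one fun h => ?_) (fun v k => ?_) x
  · rw [lp.singleContinuousLinearMap_apply, lp.norm_single (by norm_num), one_mul]
  · change S i v k = directSumRep S hS v (lp.single 2 i k) i
    rw [directSumRep_apply, lp.single_apply_self]

/-- Squared norms in the Hilbert sum split over the coordinates, so the squared estimates for the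
summands can be added. With the preceding bound, the amplified norm of the sum is the supremum of
those of its summands. -/
theorem directSumRep_ampNorm_le (S : ι → (V →L[ℂ] (H →L[ℂ] H))) (hS : ∀ i, ‖S i‖ ≤ 1)
    {m : ℕ} (x : Matrix (Fin m) (Fin m) V) {c : ℝ} (hc : 0 ≤ c)
    (h : ∀ i, ampNorm (S i : V →ₗ[ℂ] (H →L[ℂ] H)) x ≤ c) :
    ampNorm (directSumRep S hS) x ≤ c := by
  refine ampNorm_le_of_forall _ _ hc fun v => ?_
  refine hasSum_le (fun i => ?_)
    (hasSum_sum fun r _ => lp_norm_sq (∑ j, directSumRep S hS (x r j) (v j)))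
    ((hasSum_sum fun r _ => lp_norm_sq (v r)).mul_left _)
  have h1 := sum_norm_sq_le_ampNorm (S i : V →ₗ[ℂ] (H →L[ℂ] H)) x (fun j => v j i)
  have e : ∀ r, (∑ j, directSumRep S hS (x r j) (v j) : lp (fun _ : ι => H) 2) i =
      ∑ j, S i (x r j) (v j i) := by
    intro r
    rw [lp.coeFn_sum, Finset.sum_apply]
    rfl
  simp only [e]
  refine h1.trans ?_
  have := pow_le_pow_left₀ (ampNorm_nonneg _ _) (h i) 2
  gcongr

attribute [irreducible] directSumRep

end DirectSum

/-! ### Uniform complete boundedness on finite-dimensional spaces -/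

/-- A rank-one map amplifies to a scalar matrix followed by copies of `a`, and functionals are
completely bounded with cb-norm at most their norm. -/
theorem ampNorm_functional_smul_le {E : Submodule ℂ (H →L[ℂ] H)} (φ : E →L[ℂ] ℂ) (a : K →L[ℂ] K)
    {m : ℕ} (x : Matrix (Fin m) (Fin m) E) :
    ampNorm ((φ : E →ₗ[ℂ] ℂ).smulRight a) x ≤ ‖φ‖ * ‖a‖ * matNorm x := by
  have hx0 := matNorm_nonneg x
  refine ampNorm_le_of_forall _ _ (by positivity) fun v => ?_
  have h1 := sum_norm_sq_le (Matrix.of fun i j => φ (x i j)) _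
    (functional_amplification_le φ x) (fun j => a (v j))
  have h2 : ∑ j, ‖a (v j)‖ ^ 2 ≤ ‖a‖ ^ 2 * ∑ j, ‖v j‖ ^ 2 := by
    rw [Finset.mul_sum]
    refine Finset.sum_le_sum fun j _ => ?_
    rw [← mul_pow]
    gcongr
    exact a.le_opNorm (v j)
  calc _ = ∑ i, ‖∑ j, φ (x i j) • a (v j)‖ ^ 2 := by simp
    _ ≤ (‖φ‖ * matNorm x) ^ 2 * ∑ j, ‖a (v j)‖ ^ 2 := h1
    _ ≤ (‖φ‖ * matNorm x) ^ 2 * (‖a‖ ^ 2 * ∑ j, ‖v j‖ ^ 2) := by gcongr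
    _ = _ := by ring

/-- Expanding in a basis writes `R` as a sum of rank-one maps. The point is that `C` depends neither
on `R` nor on the level `m`, so closeness in operator norm gives closeness at all levels at once. -/
theorem exists_ampNorm_le {V : Type*} [NormedAddCommGroup V] [NormedSpace ℂ V]
    [FiniteDimensional ℂ V] (T : V →ₗ[ℂ] (H →L[ℂ] H)) (hT : Function.Injective T) :
    ∃ C : ℝ, 0 ≤ C ∧ ∀ (R : V →L[ℂ] (K →L[ℂ] K)) (m : ℕ) (x : Matrix (Fin m) (Fin m) V),
      ampNorm (R : V →ₗ[ℂ] (K →L[ℂ] K)) x ≤ C * ‖R‖ * ampNorm T x := by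
  let e := LinearEquiv.ofInjective T hT
  let b := Module.finBasis ℂ V
  have : FiniteDimensional ℂ (LinearMap.range T) := e.finiteDimensional
  let φ : Fin (Module.finrank ℂ V) → (LinearMap.range T →L[ℂ] ℂ) :=
    fun k => LinearMap.toContinuousLinearMap (b.coord k ∘ₗ (e.symm : LinearMap.range T →ₗ[ℂ] V))
  refine ⟨∑ k, ‖φ k‖ * ‖b k‖, by positivity, fun R m x => ?_⟩
  have hx0 := ampNorm_nonneg T x
  have hsum : x.map R =
      ∑ k, (x.map e).map ((φ k : LinearMap.range T →ₗ[ℂ] ℂ).smulRight (R (b k))) := by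
    ext1 i j
    rw [Matrix.sum_apply]
    simp only [Matrix.map_apply]
    conv_lhs => rw [← b.sum_repr (x i j), map_sum]
    refine Finset.sum_congr rfl fun k _ => ?_
    simp [φ]
  have hadd : ∀ s : Finset (Fin (Module.finrank ℂ V)),
      ‖blockOp (∑ k ∈ s, (x.map e).map ((φ k : LinearMap.range T →ₗ[ℂ] ℂ).smulRight (R (b k))))‖ ≤
        ∑ k ∈ s, ampNorm ((φ k : LinearMap.range T →ₗ[ℂ] ℂ).smulRight (R (b k))) (x.map e) := by
    classical
    intro s
    induction s using Finset.induction_on with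
    | empty =>
      have := blockOp_smul (0 : ℂ) (0 : Matrix (Fin m) (Fin m) (K →L[ℂ] K))
      rw [zero_smul, zero_smul] at this
      simp [this]
    | insert a s ha ih =>
      rw [Finset.sum_insert ha, Finset.sum_insert ha, blockOp_add]
      exact (norm_add_le _ _).trans (by gcongr; exact le_rfl)
  rw [ampNorm, ContinuousLinearMap.coe_coe, hsum]
  refine (hadd _).trans ?_
  rw [mul_assoc, Finset.sum_mul]
  refine Finset.sum_le_sum fun k _ => (ampNorm_functional_smul_le _ _ _).trans ?_
  rw [matNorm_map_ofInjective T hT x]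
  calc ‖φ k‖ * ‖R (b k)‖ * ampNorm T x ≤ ‖φ k‖ * (‖R‖ * ‖b k‖) * ampNorm T x := by
        gcongr; exact R.le_opNorm _
    _ = _ := by ring

end Amplification

section Minimal

variable {H : Type*} [NormedAddCommGroup H] [InnerProductSpace ℂ H]
variable {K : Type*} [NormedAddCommGroup K] [InnerProductSpace ℂ K]

/-- An orthonormal basis of `K` is sent to distinct members of the orthonormal family `w`. -/
theorem exists_linearIsometry [FiniteDimensional ℂ K] {ι : Type*} {w : ι → H}
    (hw : Orthonormal ℂ w) (f : Fin (Module.finrank ℂ K) → ι) (hf : Function.Injective f) :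
    Nonempty (K →ₗᵢ[ℂ] H) := by
  let b := stdOrthonormalBasis ℂ K
  refine ⟨(b.toBasis.constr ℂ (w ∘ f)).isometryOfOrthonormal (v := b.toBasis) ?_ ?_⟩
  · simp [b.orthonormal]
  · have : (b.toBasis.constr ℂ (w ∘ f)) ∘ b.toBasis = w ∘ f := by
      ext i
      simp only [Function.comp_apply, Module.Basis.constr_basis]
    rw [this]
    exact hw.comp f hf

/-! ### The minimal structure determined by the maps to `B(K)` -/

/-- The completely contractive maps `E → B(K)`. -/
def completeContractions (E : Submodule ℂ (H →L[ℂ] H)) (K : Type*) [NormedAddCommGroup K]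
    [InnerProductSpace ℂ K] :
    Set (E →L[ℂ] (K →L[ℂ] K)) :=
  {S | ∀ (m : ℕ) (x : Matrix (Fin m) (Fin m) E),
    ampNorm (S : E →ₗ[ℂ] (K →L[ℂ] K)) x ≤ matNorm x}

theorem norm_le_one_of_completeContraction {E : Submodule ℂ (H →L[ℂ] H)}
    {S : E →L[ℂ] (K →L[ℂ] K)}
    (hS : S ∈ completeContractions E K) : ‖S‖ ≤ 1 := by
  refine ContinuousLinearMap.opNorm_le_bound _ zero_le_one fun x => ?_
  have := hS 1 (Matrix.of fun _ _ => x)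
  rw [ampNorm_one, matNorm_one] at this
  rw [one_mul]
  exact this

/-- The direct sum of a set of completely contractive maps `E → B(K)`. -/
def contractionRep {E : Submodule ℂ (H →L[ℂ] H)}
    {t : Set (E →L[ℂ] (K →L[ℂ] K))}
    (ht : t ⊆ completeContractions E K) :
    E →ₗ[ℂ] (lp (fun _ : t => K) 2 →L[ℂ]
      lp (fun _ : t => K) 2) :=
  directSumRep (fun S => S.1) fun S => norm_le_one_of_completeContraction (ht S.2)

theorem ampNorm_le_contractionRep {E : Submodule ℂ (H →L[ℂ] H)}
    {t : Set (E →L[ℂ] (K →L[ℂ] K))}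
    (ht : t ⊆ completeContractions E K) {m : ℕ} (x : Matrix (Fin m) (Fin m) E)
    {S : E →L[ℂ] (K →L[ℂ] K)} (hS : S ∈ t) :
    ampNorm (S : E →ₗ[ℂ] (K →L[ℂ] K)) x ≤
      ampNorm (contractionRep ht) x :=
  ampNorm_le_directSumRep (fun S : t => S.1) _ ⟨S, hS⟩ x

theorem contractionRep_ampNorm_le {E : Submodule ℂ (H →L[ℂ] H)}
    {t : Set (E →L[ℂ] (K →L[ℂ] K))}
    (ht : t ⊆ completeContractions E K) {m : ℕ} (x : Matrix (Fin m) (Fin m) E)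
    {c : ℝ} (hc : 0 ≤ c) (h : ∀ S ∈ t, ampNorm
      (S : E →ₗ[ℂ] (K →L[ℂ] K)) x ≤ c) :
    ampNorm (contractionRep ht) x ≤ c :=
  directSumRep_ampNorm_le _ _ x hc fun S => h S.1 S.2

attribute [irreducible] contractionRep

/-- The direct sum of all completely contractive maps `E → B(K)`. -/
def kMinRep (E : Submodule ℂ (H →L[ℂ] H)) (K : Type*) [NormedAddCommGroup K]
    [InnerProductSpace ℂ K] :
    E →ₗ[ℂ] (lp (fun _ : completeContractions E K => K) 2 →L[ℂ]
      lp (fun _ : completeContractions E K => K) 2) :=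
  contractionRep (t := completeContractions E K) subset_rfl

theorem ampNorm_le_kMinRep {E : Submodule ℂ (H →L[ℂ] H)} {m : ℕ} (x : Matrix (Fin m) (Fin m) E)
    {S : E →L[ℂ] (K →L[ℂ] K)}
    (hS : S ∈ completeContractions E K) :
    ampNorm (S : E →ₗ[ℂ] (K →L[ℂ] K)) x ≤
      ampNorm (kMinRep E K) x :=
  ampNorm_le_contractionRep subset_rfl x hS

theorem kMinRep_ampNorm_le {E : Submodule ℂ (H →L[ℂ] H)} {m : ℕ} (x : Matrix (Fin m) (Fin m) E)
    {c : ℝ} (hc : 0 ≤ c) (h : ∀ S ∈ completeContractions E K, ampNorm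
      (S : E →ₗ[ℂ] (K →L[ℂ] K)) x ≤ c) :
    ampNorm (kMinRep E K) x ≤ c :=
  contractionRep_ampNorm_le subset_rfl x hc h

attribute [irreducible] kMinRep

theorem ampNorm_kMinRep_le (E : Submodule ℂ (H →L[ℂ] H)) (K : Type*) [NormedAddCommGroup K]
    [InnerProductSpace ℂ K] {m : ℕ}
    (x : Matrix (Fin m) (Fin m) E) : ampNorm (kMinRep E K) x ≤ matNorm x :=
  kMinRep_ampNorm_le x (matNorm_nonneg x) fun _ hS => hS m x

/-- Vectors and their images are captured by a compression to a space of small dimension. -/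
theorem exists_compression (E : Submodule ℂ (H →L[ℂ] H)) [FiniteDimensional ℂ K] {m : ℕ}
    (hk : 2 * m ≤ Module.finrank ℂ K)
    (x : Matrix (Fin m) (Fin m) E) (h : Fin m → H) :
    ∃ (S : completeContractions E K) (v : Fin m → K),
      (∀ j, ‖v j‖ = ‖h j‖) ∧
      ∀ i, ‖∑ j, S.1 (x i j) (v j)‖ = ‖∑ j, (x i j : H →L[ℂ] H) (h j)‖ := by
  -- The `m` test vectors and their `m` images under the matrix: this is the source of the factor 2
  -- in `hk`.
  let g : Fin m ⊕ Fin m → H := Sum.elim h fun i => ∑ j, (x i j : H →L[ℂ] H) (h j)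
  let D : Submodule ℂ H := Submodule.span ℂ (Set.range g)
  have : FiniteDimensional ℂ D := FiniteDimensional.span_of_finite ℂ (Set.finite_range g)
  have hD : Module.finrank ℂ D ≤ Module.finrank ℂ K := by
    refine (finrank_range_le_card (R := ℂ) g).trans ?_
    simp only [Fintype.card_sum, Fintype.card_fin]
    omega
  obtain ⟨J⟩ : Nonempty (D →ₗᵢ[ℂ] K) :=
    exists_linearIsometry (stdOrthonormalBasis ℂ K).orthonormal (Fin.castLE hD)
      (Fin.castLE_injective hD)
  have : CompleteSpace K := FiniteDimensional.complete ℂ K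
  let J' : D →L[ℂ] K := J.toContinuousLinearMap
  have hJ : ‖J'‖ ≤ 1 := J.norm_toContinuousLinearMap_le
  have hJJ : ∀ d, J'.adjoint (J' d) = d := by
    intro d
    refine ext_inner_left ℂ fun e => ?_
    rw [ContinuousLinearMap.adjoint_inner_right]
    exact J.inner_map_map e d
  -- The compression of `E` to `D`, transported to `K` by `J`. `B` returns the copies of the test
  -- vectors to `h j`, and `A` preserves norms on `D`, where the images lie; so nothing is lost at
  -- these vectors.
  let A : H →L[ℂ] K := J' ∘L D.orthogonalProjectionOnto
  let B : K →L[ℂ] H := D.subtypeL ∘L J'.adjoint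
  have hA : ‖A‖ ≤ 1 := (ContinuousLinearMap.opNorm_comp_le _ _).trans
    (mul_le_one₀ hJ (norm_nonneg _) D.orthogonalProjectionOnto_norm_le)
  have hB : ‖B‖ ≤ 1 := (ContinuousLinearMap.opNorm_comp_le _ _).trans
    (mul_le_one₀ D.norm_subtypeL_le (norm_nonneg _) (by simpa using hJ))
  let S : E →ₗ[ℂ] (K →L[ℂ] K) :=
    { toFun := fun e => A ∘L (e : H →L[ℂ] H) ∘L B
      map_add' := fun e f => by ext; simp
      map_smul' := fun c e => by ext; simp }
  have hS : ∀ (e : E) v, S e v = A ((e : H →L[ℂ] H) (B v)) := fun _ _ => rfl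
  have hle : ∀ (l : ℕ) (y : Matrix (Fin l) (Fin l) E), ampNorm S y ≤ matNorm y := fun l y =>
    ampNorm_le_of_compress E.subtype S A B hA hB hS y
  have hS1 : ∀ e, ‖S e‖ ≤ 1 * ‖e‖ := by
    intro e
    have := hle 1 (Matrix.of fun _ _ => e)
    rw [ampNorm_one, matNorm_one] at this
    rw [one_mul]
    exact this
  have hgD : ∀ s, g s ∈ D := fun s => Submodule.subset_span ⟨s, rfl⟩
  have hBh : ∀ j, B (J' ⟨h j, hgD (Sum.inl j)⟩) = h j := by
    intro j
    change ((J'.adjoint (J' ⟨h j, hgD (Sum.inl j)⟩) : D) : H) = h j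
    rw [hJJ]
  have hAn : ∀ d : D, ‖A d‖ = ‖d‖ := by
    intro d
    change ‖J (D.orthogonalProjectionOnto d)‖ = _
    rw [J.norm_map, Submodule.orthogonalProjectionOnto_mem_subspace_eq_self]
  refine ⟨⟨S.mkContinuous 1 hS1, hle⟩, fun j => J' ⟨h j, hgD (Sum.inl j)⟩, fun j => ?_, fun i => ?_⟩
  · exact J.norm_map _
  · have e1 : ∑ j, S.mkContinuous 1 hS1 (x i j) (J' ⟨h j, hgD (Sum.inl j)⟩) =
        A (∑ j, (x i j : H →L[ℂ] H) (h j)) := by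
      rw [map_sum]
      refine Finset.sum_congr rfl fun j _ => ?_
      rw [LinearMap.mkContinuous_apply, hS, hBh]
    rw [e1]
    exact hAn ⟨_, hgD (Sum.inr i)⟩

/-- At each tuple of test vectors, some complete contraction into `B(K)` reproduces the norms of the
vectors and of their images, so the supremum over all contractions recovers the original norm. -/
theorem ampNorm_kMinRep (E : Submodule ℂ (H →L[ℂ] H)) [FiniteDimensional ℂ K] {m : ℕ}
    (hk : 2 * m ≤ Module.finrank ℂ K)
    (x : Matrix (Fin m) (Fin m) E) : ampNorm (kMinRep E K) x = matNorm x := by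
  refine le_antisymm (ampNorm_kMinRep_le E K x) ?_
  rw [matNorm_eq_ampNorm]
  refine ampNorm_le_of_forall _ _ (ampNorm_nonneg _ _) fun h => ?_
  obtain ⟨S, v, hv, hS⟩ := exists_compression E hk x h
  have h1 := sum_norm_sq_le_ampNorm (S.1 : E →ₗ[ℂ] _) x v
  simp only [ContinuousLinearMap.coe_coe, hv, hS] at h1
  refine h1.trans ?_
  gcongr
  · exact ampNorm_nonneg _ _
  · exact ampNorm_le_kMinRep x S.2

theorem kMinRep_norm (E : Submodule ℂ (H →L[ℂ] H)) [FiniteDimensional ℂ K]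
    (hk : 2 ≤ Module.finrank ℂ K) (x : E) :
    ‖kMinRep E K x‖ = ‖x‖ := by
  rw [← ampNorm_one, ampNorm_kMinRep E (by omega), matNorm_one]
  rfl

theorem kMinRep_injective (E : Submodule ℂ (H →L[ℂ] H)) [FiniteDimensional ℂ K]
    (hk : 2 ≤ Module.finrank ℂ K) :
    Function.Injective (kMinRep E K) := by
  refine (injective_iff_map_eq_zero _).2 fun x hx => ?_
  rw [← norm_eq_zero, ← kMinRep_norm E hk, hx, norm_zero]

/-! ### Matricial spaces have `d_SK = 1` -/

/-- `K` embeds isometrically in `ℓ²`, and the operators carried over have finite rank, hence are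
compact. So the image of `T` is an admissible competitor for `dSK`. -/
theorem dSK_le_of_rep {E : Submodule ℂ (H →L[ℂ] H)} [FiniteDimensional ℂ K]
    (T : E →ₗ[ℂ] (K →L[ℂ] K)) {c : ℝ} (hc : 0 ≤ c)
    (h1 : ∀ (m : ℕ) (x : Matrix (Fin m) (Fin m) E), ampNorm T x ≤ matNorm x)
    (h2 : ∀ (m : ℕ) (x : Matrix (Fin m) (Fin m) E), matNorm x ≤ c * ampNorm T x) :
    dSK E ≤ ENNReal.ofReal c := by
  have : CompleteSpace K := FiniteDimensional.complete ℂ K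
  obtain ⟨J⟩ : Nonempty (K →ₗᵢ[ℂ] lp (fun _ : ℕ => ℂ) 2) :=
    exists_linearIsometry (default : HilbertBasis ℕ ℂ (lp (fun _ : ℕ => ℂ) 2)).orthonormal
      (fun i => (i : ℕ)) Fin.val_injective
  let J' : K →L[ℂ] lp (fun _ : ℕ => ℂ) 2 := J.toContinuousLinearMap
  have hJ : ‖J'‖ ≤ 1 := J.norm_toContinuousLinearMap_le
  have hJ2 : ‖J'.adjoint‖ ≤ 1 := by simpa using hJ
  have hJJ : ∀ d, J'.adjoint (J' d) = d := by
    intro d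
    refine ext_inner_left ℂ fun e => ?_
    rw [ContinuousLinearMap.adjoint_inner_right]
    exact J.inner_map_map e d
  let S : E →ₗ[ℂ] (lp (fun _ : ℕ => ℂ) 2 →L[ℂ] lp (fun _ : ℕ => ℂ) 2) :=
    { toFun := fun e => J' ∘L T e ∘L J'.adjoint
      map_add' := fun e f => by ext1; simp
      map_smul' := fun c e => by ext1; simp }
  -- Each of `S` and `T` is a compression of the other, because `J'.adjoint` is a left inverse of
  -- `J'`.
  have hST : ∀ (m : ℕ) (x : Matrix (Fin m) (Fin m) E), ampNorm S x = ampNorm T x := fun m x =>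
    le_antisymm
      (ampNorm_le_of_compress T S J' J'.adjoint hJ hJ2 (fun _ _ => rfl) x)
      (ampNorm_le_of_compress S T J'.adjoint J' hJ2 hJ (fun v k => by
        change T v k = J'.adjoint (J' (T v (J'.adjoint (J' k))))
        rw [hJJ, hJJ]) x)
  have hS : Function.Injective S := by
    refine (injective_iff_map_eq_zero _).2 fun x hx => ?_
    have := h2 1 (Matrix.of fun _ _ => x)
    rw [← hST, ampNorm_one, hx, norm_zero, mul_zero, matNorm_one] at this
    exact norm_le_zero_iff.1 this
  refine (iInf₂_le (LinearMap.range S) ?_).trans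
    ((iInf_le _ (LinearEquiv.ofInjective S hS)).trans ?_)
  · rintro _ ⟨x, rfl⟩
    have hT : IsCompactOperator (T x ∘L J'.adjoint) :=
      ((isCompactOperator_id_iff_finiteDimensional (𝕜 := ℂ) (E := K)).2 inferInstance).comp_clm _
    exact hT.clm_comp J'
  · calc _ ≤ ENNReal.ofReal 1 * ENNReal.ofReal c := by
          refine mul_le_mul' (cbNorm_le zero_le_one fun m x => ?_) (cbNorm_le hc fun m y => ?_)
          · rw [one_mul]
            exact (matNorm_map_ofInjective S hS x).trans_le ((hST m x).trans_le (h1 m x))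
          · obtain ⟨x, rfl⟩ : ∃ x : Matrix (Fin m) (Fin m) E,
                y = x.map (LinearEquiv.ofInjective S hS) :=
              ⟨y.map (LinearEquiv.ofInjective S hS).symm, by ext1 i j; simp⟩
            rw [matNorm_map_ofInjective, hST]
            convert! h2 m x using 2
            ext1 i j
            simp
      _ = _ := by simp

theorem dSK_range_le {V : Type*} [AddCommGroup V] [Module ℂ V] [FiniteDimensional ℂ K]
    (T : V →ₗ[ℂ] (H →L[ℂ] H)) (hT : Function.Injective T) (R : V →ₗ[ℂ] (K →L[ℂ] K))
    {c : ℝ} (hc : 0 ≤ c)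
    (h1 : ∀ (m : ℕ) (x : Matrix (Fin m) (Fin m) V), ampNorm R x ≤ ampNorm T x)
    (h2 : ∀ (m : ℕ) (x : Matrix (Fin m) (Fin m) V), ampNorm T x ≤ c * ampNorm R x) :
    dSK (LinearMap.range T) ≤ ENNReal.ofReal c :=
  dSK_le_of_rep (R ∘ₗ ((LinearEquiv.ofInjective T hT).symm : LinearMap.range T →ₗ[ℂ] V)) hc
    (fun m y => by rw [matNorm_eq_ampNorm_symm T hT, ampNorm_comp]; exact h1 m _)
    (fun m y => by rw [matNorm_eq_ampNorm_symm T hT, ampNorm_comp]; exact h2 m _)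

theorem finiteDimensional_lp {ι : Type*} [Finite ι] [FiniteDimensional ℂ K] :
    FiniteDimensional ℂ (lp (fun _ : ι => K) 2) :=
  FiniteDimensional.of_injective (V₂ := ι → K)
    { toFun := fun f i => f i
      map_add' := fun _ _ => rfl
      map_smul' := fun _ _ => rfl } fun _ _ h => lp.ext h

/-- Up to `ε`, finitely many complete contractions determine the minimal structure. -/
theorem exists_finite_le_kMinRep (E : Submodule ℂ (H →L[ℂ] H)) [FiniteDimensional ℂ E]
    [FiniteDimensional ℂ K]    (hk : 2 ≤ Module.finrank ℂ K) {ε : ℝ} (hε : 0 < ε) :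
    ∃ t : Set (E →L[ℂ] (K →L[ℂ] K)), t.Finite ∧ t ⊆ completeContractions E K ∧
      ∀ (m : ℕ) (x : Matrix (Fin m) (Fin m) E) (c : ℝ), 0 ≤ c →
        (∀ S ∈ t, ampNorm (S : E →ₗ[ℂ] (K →L[ℂ] K)) x ≤ c) →
        ampNorm (kMinRep E K) x ≤ (1 + ε) * c := by
  obtain ⟨C, hC, hCb⟩ :=
    exists_ampNorm_le (K := K) _ (kMinRep_injective E hk)
  -- Chosen so that the error `C * δ` is at most `ε / (1 + ε)`, hence can be absorbed on the left;
  -- `C + 1` keeps the denominator positive.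
  set δ : ℝ := ε / ((C + 1) * (1 + ε)) with hδ
  have hδ0 : 0 < δ := by positivity
  have hδC : C * δ * (1 + ε) ≤ ε := by
    have : C * δ * (1 + ε) = C / (C + 1) * ε := by rw [hδ]; field_simp
    rw [this]
    exact mul_le_of_le_one_left hε.le (div_le_one_of_le₀ (by linarith) (by positivity))
  have hproper : ProperSpace (E →L[ℂ] (K →L[ℂ] K)) :=
    FiniteDimensional.proper ℂ _
  have htb : TotallyBounded (completeContractions E K) :=
    (isCompact_closedBall 0 1).totallyBounded.subset fun S hS => by
      simpa using norm_le_one_of_completeContraction hS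
  obtain ⟨t, ht, htf, hcov⟩ := Metric.finite_approx_of_totallyBounded htb δ hδ0
  refine ⟨t, htf, ht, fun m x c hc hx => ?_⟩
  have h0 := ampNorm_nonneg (kMinRep E K) x
  -- Replacing `S` by a nearby member of the net costs at most `C * δ` times the minimal norm
  -- itself, which is why `C` was taken relative to `kMinRep`.
  have h3 : ampNorm (kMinRep E K) x ≤ c + C * δ * ampNorm (kMinRep E K) x := by
    refine kMinRep_ampNorm_le x (by positivity) fun S hS => ?_
    obtain ⟨S', hS', hdist⟩ := Set.mem_iUnion₂.1 (hcov hS)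
    refine (ampNorm_coe_sub_le S S' x).trans (add_le_add (hx S' hS') ?_)
    rw [Metric.mem_ball, dist_eq_norm] at hdist
    exact (hCb (S - S') m x).trans
      (mul_le_mul_of_nonneg_right (mul_le_mul_of_nonneg_left hdist.le hC) h0)
  have h4 : ampNorm (kMinRep E K) x * (1 + ε) ≤
      (c + C * δ * ampNorm (kMinRep E K) x) * (1 + ε) :=
    mul_le_mul_of_nonneg_right h3 (by positivity)
  have h5 := mul_le_mul_of_nonneg_right hδC h0
  linarith

/-- A finite direct sum of copies of `K` is finite-dimensional, so the sum over a finite net is a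
matricial model within `1 + ε` of the minimal structure. -/
theorem dSK_kMinRep_le (E : Submodule ℂ (H →L[ℂ] H)) [FiniteDimensional ℂ E]
    [FiniteDimensional ℂ K] (hk : 2 ≤ Module.finrank ℂ K) {ε : ℝ} (hε : 0 < ε) :
    dSK (LinearMap.range (kMinRep E K)) ≤ ENNReal.ofReal (1 + ε) := by
  have hnet := exists_finite_le_kMinRep (K := K) E hk hε
  obtain ⟨t, htf, ht, hle⟩ := hnet
  have : Finite t := htf.to_subtype
  have hfin : FiniteDimensional ℂ (lp (fun _ : t => K) 2) := finiteDimensional_lp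
  refine dSK_range_le (kMinRep E K) (kMinRep_injective E hk) (contractionRep ht)
    (by positivity) (fun m x => ?_) (fun m x => ?_)
  · exact contractionRep_ampNorm_le ht x (ampNorm_nonneg _ _) fun S hS =>
      ampNorm_le_kMinRep x (ht hS)
  · exact hle m x _ (ampNorm_nonneg _ _) fun S hS => ampNorm_le_contractionRep ht x hS

theorem dSK_kMinRep_le_one (E : Submodule ℂ (H →L[ℂ] H)) [FiniteDimensional ℂ E]
    [FiniteDimensional ℂ K]
    (hk : 2 ≤ Module.finrank ℂ K) :
    dSK (LinearMap.range (kMinRep E K)) ≤ 1 := by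
  refine ENNReal.le_of_forall_pos_le_add fun ε hε _ => ?_
  refine (dSK_kMinRep_le E hk (NNReal.coe_pos.2 hε)).trans_eq ?_
  rw [ENNReal.ofReal_add zero_le_one ε.coe_nonneg, ENNReal.ofReal_one, ENNReal.ofReal_coe_nnreal]

end Minimal

section Limits

variable {H : Type*} [NormedAddCommGroup H] [InnerProductSpace ℂ H]
variable {K : Type*} [NormedAddCommGroup K] [InnerProductSpace ℂ K]
variable {E : Submodule ℂ (H →L[ℂ] H)} {F : Submodule ℂ (K →L[ℂ] K)}

/-! ### Isomorphisms of small distortion and their limits -/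

theorem dSK_le_mul [FiniteDimensional ℂ E] [FiniteDimensional ℂ F] [Nontrivial E] [Nontrivial F]
    (h : Module.finrank ℂ E = Module.finrank ℂ F) : dSK E ≤ dcb E F * dSK F := by
  have h0 : dcb E F ≠ 0 := (zero_lt_one.trans_le one_le_dcb).ne'
  rw [dSK.eq_def F, ENNReal.mul_iInf_of_ne h0 (dcb_ne_top h)]
  refine le_iInf fun G => ?_
  rw [ENNReal.mul_iInf_of_ne h0 (dcb_ne_top h)]
  refine le_iInf fun hG => (iInf₂_le G hG).trans ?_
  -- A competitor `G` need not be isomorphic to `F`; then `dcb F G = ⊤` and the bound is trivial.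
  -- Otherwise `G` is finite-dimensional and the triangle inequality applies.
  rcases isEmpty_or_nonempty (F ≃ₗ[ℂ] G) with hFG | ⟨⟨w⟩⟩
  · rw [dcb.eq_def F G, iInf_of_empty, ENNReal.mul_top h0]
    exact le_top
  · have : FiniteDimensional ℂ G := w.finiteDimensional
    exact dcb_triangle h

/-- Dividing a near-optimal `u` by `s = ‖u‖_cb` makes it completely contractive and moves all the
distortion to the inverse. -/
theorem exists_equiv_of_dcb_lt [FiniteDimensional ℂ E] [FiniteDimensional ℂ F] [Nontrivial E]
    {c : ℝ} (hc : 0 < c) (h : dcb E F < ENNReal.ofReal c) :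
    ∃ u : E ≃ₗ[ℂ] F,
      (∀ (m : ℕ) (x : Matrix (Fin m) (Fin m) E), matNorm (x.map u) ≤ matNorm x) ∧
      ∀ (m : ℕ) (y : Matrix (Fin m) (Fin m) F), matNorm (y.map u.symm) ≤ c * matNorm y := by
  obtain ⟨u, hu⟩ := iInf_lt_iff.1 h
  have h1 : (1 : ℝ≥0∞) ≤ cbNorm (u : E →ₗ[ℂ] F) * cbNorm (u.symm : F →ₗ[ℂ] E) :=
    one_le_dcb.trans (iInf_le _ u)
  set s := (cbNorm (u : E →ₗ[ℂ] F)).toReal with hs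
  set t := (cbNorm (u.symm : F →ₗ[ℂ] E)).toReal with ht
  have hs' := ENNReal.ofReal_toReal (cbNorm_ne_top (u : E →ₗ[ℂ] F))
  have ht' := ENNReal.ofReal_toReal (cbNorm_ne_top (u.symm : F →ₗ[ℂ] E))
  have hs0 : 0 < s := by
    refine ENNReal.toReal_pos (fun h => ?_) (cbNorm_ne_top _)
    rw [h, zero_mul] at h1
    exact absurd h1 (by simp)
  have ht0 : 0 ≤ t := ENNReal.toReal_nonneg
  rw [← hs', ← ht', ← ENNReal.ofReal_mul ENNReal.toReal_nonneg] at hu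
  have hst : s * t ≤ c := (ENNReal.ofReal_le_ofReal_iff hc.le).1 hu.le
  have hsC : (s : ℂ) ≠ 0 := by exact_mod_cast hs0.ne'
  let w : E ≃ₗ[ℂ] F := u.trans (LinearEquiv.smulOfNeZero ℂ F ((s⁻¹ : ℝ) : ℂ)
    (by exact_mod_cast (inv_pos.2 hs0).ne'))
  have hw : ∀ e, w e = ((s⁻¹ : ℝ) : ℂ) • u e := fun _ => rfl
  have hws : ∀ f, w.symm f = (s : ℂ) • u.symm f := by
    intro f
    rw [LinearEquiv.symm_apply_eq, hw, map_smul, smul_smul, LinearEquiv.apply_symm_apply,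
      Complex.ofReal_inv, inv_mul_cancel₀ hsC, one_smul]
  refine ⟨w, fun m x => ?_, fun m y => ?_⟩
  · have e : x.map w = ((s⁻¹ : ℝ) : ℂ) • x.map u := by ext1 i j; exact hw _
    rw [e, matNorm_smul, Complex.norm_real, Real.norm_of_nonneg (by positivity),
      inv_mul_le_iff₀ hs0]
    exact le_of_cbNorm_le hs0.le hs'.ge x
  · have e : y.map w.symm = (s : ℂ) • y.map u.symm := by ext1 i j; exact hws _
    rw [e, matNorm_smul, Complex.norm_real, Real.norm_of_nonneg hs0.le]
    have h2 : matNorm (y.map u.symm) ≤ t * matNorm y := le_of_cbNorm_le ht0 ht'.ge y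
    calc s * matNorm (y.map u.symm) ≤ s * (t * matNorm y) := by gcongr
      _ = (s * t) * matNorm y := by ring
      _ ≤ _ := mul_le_mul_of_nonneg_right hst (matNorm_nonneg y)

/-- A sequence of almost isometric isomorphisms subconverges to an isomorphism which is isometric
at each matrix level at which the sequence is eventually almost isometric. -/
theorem exists_limit_equiv [FiniteDimensional ℂ E] [FiniteDimensional ℂ F] (u : ℕ → (E ≃ₗ[ℂ] F))
    (h1 : ∀ k x, ‖u k x‖ ≤ ‖x‖) (h2 : ∀ k y, ‖(u k).symm y‖ ≤ (1 + 1 / ((k : ℝ) + 1)) * ‖y‖) :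
    ∃ v : E ≃ₗ[ℂ] F, ∀ m : ℕ,
      (∀ᶠ k in Filter.atTop,
        (∀ x : Matrix (Fin m) (Fin m) E, matNorm (x.map (u k)) ≤ matNorm x) ∧
        ∀ y : Matrix (Fin m) (Fin m) F,
          matNorm (y.map (u k).symm) ≤ (1 + 1 / ((k : ℝ) + 1)) * matNorm y) →
      ∀ x : Matrix (Fin m) (Fin m) E, matNorm (x.map v) = matNorm x := by
  obtain ⟨A, B, φ, hφ, hA, hB, hBA, hAB⟩ := exists_limit_inverse_pair
    (fun k => LinearMap.toContinuousLinearMap (u k : E →ₗ[ℂ] F))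
    (fun k => LinearMap.toContinuousLinearMap ((u k).symm : F →ₗ[ℂ] E))
    (fun k => (u k).symm_apply_apply) (fun k => (u k).apply_symm_apply)
    (fun k => ContinuousLinearMap.opNorm_le_bound _ zero_le_one fun x => by
      rw [one_mul]; exact h1 k x)
    (fun k => ContinuousLinearMap.opNorm_le_bound _ zero_le_two fun y => by
      refine (h2 k y).trans (mul_le_mul_of_nonneg_right ?_ (norm_nonneg y))
      have : 1 / ((k : ℝ) + 1) ≤ 1 := by
        rw [div_le_one (by positivity)]
        linarith [(Nat.cast_nonneg k : (0 : ℝ) ≤ k)]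
      linarith)
  refine ⟨LinearEquiv.ofLinearMap (A : E →ₗ[ℂ] F) (B : F →ₗ[ℂ] E) (LinearMap.ext hAB)
    (LinearMap.ext hBA), fun m hm => ?_⟩
  have hm' := hφ.tendsto_atTop.eventually hm
  have hA1 : ∀ x : Matrix (Fin m) (Fin m) E, matNorm (x.map A) ≤ matNorm x := fun x =>
    le_of_tendsto (((continuous_matNorm_map x).tendsto A).comp hA) (hm'.mono fun k hk => hk.1 x)
  have hB1 : ∀ y : Matrix (Fin m) (Fin m) F, matNorm (y.map B) ≤ matNorm y := by
    intro y
    have hε : Filter.Tendsto (fun k : ℕ => (1 + 1 / (((φ k : ℕ) : ℝ) + 1)) * matNorm y)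
        Filter.atTop (nhds ((1 + 0) * matNorm y)) :=
      ((tendsto_one_div_add_atTop_nhds_zero_nat.comp hφ.tendsto_atTop).const_add 1).mul_const _
    rw [add_zero, one_mul] at hε
    exact le_of_tendsto_of_tendsto (((continuous_matNorm_map y).tendsto B).comp hB) hε
      (hm'.mono fun k hk => hk.2 y)
  intro x
  refine le_antisymm (hA1 x) ?_
  -- The inverse is contractive at this level too, which gives the reverse inequality.
  have := hB1 (x.map A)
  have e : (x.map A).map B = x := by ext1 i j; simp [hBA]
  rwa [e] at this

theorem norm_le_of_matNorm_map_le {u : E →ₗ[ℂ] F} {c : ℝ}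
    (h : ∀ x : Matrix (Fin 1) (Fin 1) E, matNorm (x.map u) ≤ c * matNorm x) (x : E) :
    ‖u x‖ ≤ c * ‖x‖ := by
  simpa [matNorm_one] using h (Matrix.of fun _ _ => x)

end Limits

/-! ### The space `OS_n` -/

/-- Dimension zero is treated apart because `dcb` is then 0 and the estimates based on `one_le_dcb`
fail. -/
theorem FinDim.dSK_dim_zero (X : FinDim.{u} 0) : dSK X.E ≤ 1 := by
  have := Module.finrank_zero_iff.1 X.finrank_eq
  rw [← ENNReal.ofReal_one]
  have h0 : ∀ (m : ℕ) (x : Matrix (Fin m) (Fin m) X.E), matNorm x = 0 := by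
    intro m x
    have hx : x = (0 : ℂ) • x := by ext1 i j; exact Subsingleton.elim _ _
    rw [hx, matNorm_smul]
    simp
  have hT : ∀ (m : ℕ) (x : Matrix (Fin m) (Fin m) X.E),
      ampNorm (0 : X.E →ₗ[ℂ] (EuclideanSpace ℂ (Fin 0) →L[ℂ] EuclideanSpace ℂ (Fin 0))) x ≤ 0 :=
    fun m x => ampNorm_le_of_forall _ _ le_rfl (by simp)
  refine dSK_le_of_rep (0 : X.E →ₗ[ℂ] (EuclideanSpace ℂ (Fin 0) →L[ℂ] EuclideanSpace ℂ (Fin 0)))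
    zero_le_one (fun m x => ?_) (fun m x => ?_)
  · rw [h0]
    exact hT m x
  · rw [h0, one_mul]
    exact ampNorm_nonneg _ _

theorem FinDim.dcb_lt_of_dist_lt {n : ℕ} (hn : n ≠ 0) {X Y : FinDim.{u} n} {c : ℝ} (hc : 0 < c)
    (h : dist (OS.mk X) (OS.mk Y) < Real.log c) : dcb X.E Y.E < ENNReal.ofReal c := by
  have := X.nontrivial hn
  have hpos : 0 < (dcb X.E Y.E).toReal :=
    ENNReal.toReal_pos (zero_lt_one.trans_le one_le_dcb).ne' (FinDim.dcb_ne_top X Y)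
  have h' : Real.log (dcb X.E Y.E).toReal < Real.log c := h
  rw [← ENNReal.ofReal_toReal (FinDim.dcb_ne_top X Y), ENNReal.ofReal_lt_ofReal_iff hc]
  exact (Real.log_lt_log_iff hpos hc).1 h'

theorem log_one_add_pos (k : ℕ) : 0 < Real.log (1 + 1 / ((k : ℝ) + 1)) :=
  Real.log_pos (by have : 0 < 1 / ((k : ℝ) + 1) := by positivity
                   linarith)

/-- The image of an `n`-dimensional operator space under an injective representation. -/
def FinDim.ofRep {n : ℕ} (E : FinDim.{u} n) {L : Type u} [NormedAddCommGroup L]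
    [InnerProductSpace ℂ L] [CompleteSpace L] (T : E.E →ₗ[ℂ] (L →L[ℂ] L))
    (hT : Function.Injective T) : FinDim.{u} n where
  H := L
  E := LinearMap.range T
  finiteDimensional := inferInstance
  finrank_eq := (LinearMap.finrank_range_of_inj hT).trans E.finrank_eq

theorem completeSpace_lp {K ι : Type*} [NormedAddCommGroup K] [CompleteSpace K] :
    CompleteSpace (lp (fun _ : ι => K) 2) :=
  inferInstance

/-! ### Minimal structures as points of the isometry class -/

section Min

-- With `K` in the lowest universe, the Hilbert sum over all complete contractions stays in universe
-- `u`, so the new space is a point of the same `OS n`.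
variable {n : ℕ} (E : FinDim.{u} n) (K : Type) [NormedAddCommGroup K] [InnerProductSpace ℂ K]
  [FiniteDimensional ℂ K] (hK : 2 ≤ Module.finrank ℂ K)

/-- The `n`-dimensional space `E` with the minimal structure determined by the complete
contractions into `B(K)`. -/
def FinDim.min : FinDim.{u} n :=
  have : CompleteSpace K := FiniteDimensional.complete ℂ K
  have := completeSpace_lp (K := K) (ι := completeContractions E.E K)
  E.ofRep (kMinRep E.E K) (kMinRep_injective E.E hK)

theorem FinDim.dSK_min : dSK (E.min K hK).E ≤ 1 :=
  dSK_kMinRep_le_one E.E hK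

/-- The identity from the minimal structure to the given one. -/
def FinDim.minEquiv : (E.min K hK).E ≃ₗ[ℂ] E.E :=
  (LinearEquiv.ofInjective (kMinRep E.E K) (kMinRep_injective E.E hK)).symm

theorem FinDim.matNorm_minEquiv {m : ℕ} (hm : 2 * m ≤ Module.finrank ℂ K)
    (y : Matrix (Fin m) (Fin m) (E.min K hK).E) :
    matNorm (y.map (E.minEquiv K hK)) = matNorm y :=
  ((ampNorm_kMinRep E.E hm _).symm.trans
    (matNorm_eq_ampNorm_symm _ (kMinRep_injective E.E hK) y).symm)

theorem FinDim.norm_minEquiv (y : (E.min K hK).E) : ‖E.minEquiv K hK y‖ = ‖y‖ := by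
  have := E.matNorm_minEquiv K hK (m := 1) (by omega) (Matrix.of fun _ _ => y)
  simpa [matNorm_one] using this

theorem OS.min_mem_isometricTo : OS.mk (E.min K hK) ∈ OS.isometricTo E :=
  ⟨E.min K hK, rfl, ⟨⟨E.minEquiv K hK, E.norm_minEquiv K hK⟩⟩⟩

end Min

/-- The shift by 2 makes level one isometric for every `k`, so that the whole sequence lies in the
isometry class. -/
theorem two_le_finrank_euclideanSpace (k : ℕ) :
    2 ≤ Module.finrank ℂ (EuclideanSpace ℂ (Fin (k + 2))) := by simp

/-- The `n`-dimensional space `E` with its `(k + 2)`-minimal structure. -/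
def FinDim.kMin {n : ℕ} (E : FinDim.{u} n) (k : ℕ) : FinDim.{u} n :=
  E.min (EuclideanSpace ℂ (Fin (k + 2))) (two_le_finrank_euclideanSpace k)

theorem FinDim.dSK_kMin {n : ℕ} (E : FinDim.{u} n) (k : ℕ) : dSK (E.kMin k).E ≤ 1 :=
  E.dSK_min _ _

theorem OS.kMin_mem_isometricTo {n : ℕ} (E : FinDim.{u} n) (k : ℕ) :
    OS.mk (E.kMin k) ∈ OS.isometricTo E :=
  OS.min_mem_isometricTo E _ _

/-- The identity from the `(k + 2)`-minimal structure to the given one. -/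
def FinDim.kMinEquiv {n : ℕ} (E : FinDim.{u} n) (k : ℕ) : (E.kMin k).E ≃ₗ[ℂ] E.E :=
  E.minEquiv (EuclideanSpace ℂ (Fin (k + 2))) (two_le_finrank_euclideanSpace k)

theorem FinDim.matNorm_kMinEquiv {n : ℕ} (E : FinDim.{u} n) {k m : ℕ} (hm : 2 * m ≤ k + 2)
    (y : Matrix (Fin m) (Fin m) (E.kMin k).E) : matNorm (y.map (E.kMinEquiv k)) = matNorm y :=
  E.matNorm_minEquiv _ (two_le_finrank_euclideanSpace k) (by simpa using hm) y

/-! ### Closedness of the isometry class -/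

theorem OS.isClosed_isometricTo {n : ℕ} (hn : n ≠ 0) (E : FinDim.{u} n) :
    IsClosed (OS.isometricTo E) := by
  refine isClosed_of_closure_subset fun X hX => ?_
  induction X using Quotient.inductionOn with | h X => ?_
  have := X.nontrivial hn
  have key : ∀ k : ℕ, ∃ u : X.E ≃ₗ[ℂ] E.E, (∀ x, ‖u x‖ ≤ ‖x‖) ∧
      ∀ y, ‖u.symm y‖ ≤ (1 + 1 / ((k : ℝ) + 1)) * ‖y‖ := by
    intro k
    obtain ⟨_, ⟨F, rfl, ⟨w⟩⟩, hF⟩ := Metric.mem_closure_iff.1 hX _ (log_one_add_pos k)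
    obtain ⟨u, hu, hu'⟩ := exists_equiv_of_dcb_lt (by positivity)
      (FinDim.dcb_lt_of_dist_lt hn (by positivity) hF)
    refine ⟨u.trans w.toLinearEquiv, fun x => ?_, fun y => ?_⟩
    · have h1 := norm_le_of_matNorm_map_le (u := (u : X.E →ₗ[ℂ] F.E)) (c := 1)
        (fun x => by rw [one_mul]; exact hu 1 x) x
      rw [one_mul] at h1
      exact (w.norm_map (u x)).trans_le h1
    · have h1 := norm_le_of_matNorm_map_le (u := (u.symm : F.E →ₗ[ℂ] X.E)) (hu' 1) (w.symm y)
      rw [w.symm.norm_map] at h1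
      exact h1
  choose u hu hu' using key
  -- Only the norms are controlled, since the isometries `w` say nothing about higher levels; hence
  -- only level one survives in the limit.
  obtain ⟨v, hv⟩ := exists_limit_equiv u hu hu'
  have hv1 := hv 1 (Filter.Eventually.of_forall fun k =>
    ⟨fun x => by rw [matNorm_one, matNorm_one]; exact hu k _,
      fun y => by rw [matNorm_one, matNorm_one]; exact hu' k _⟩)
  refine ⟨X, rfl, ⟨⟨v, fun x => ?_⟩⟩⟩
  simpa [matNorm_one] using hv1 (Matrix.of fun _ _ => x)

/-! ### Failure of compactness -/

/-- The space `E` is completely isometric to every cluster point of its `k`-minimal structures. -/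
theorem FinDim.exists_isCompleteIsometry_of_dcb_kMin_lt {n : ℕ} (hn : n ≠ 0) (E X : FinDim.{u} n)
    (i : ℕ → ℕ) (hi : ∀ j, j ≤ i j)
    (h : ∀ j : ℕ, dcb X.E (E.kMin (i j)).E < ENNReal.ofReal (1 + 1 / ((j : ℝ) + 1))) :
    ∃ v : X.E ≃ₗ[ℂ] E.E, IsCompleteIsometry v := by
  have := X.nontrivial hn
  have key := fun j => exists_equiv_of_dcb_lt (by positivity) (h j)
  choose w hw hw' using key
  -- The second factor is not assumed isometric at all levels, but it is at every level `m` with `2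
  -- * m ≤ i j + 2`. As `i j ≥ j`, each fixed level is eventually covered, and level one is covered
  -- for all `j`.
  let u : ℕ → (X.E ≃ₗ[ℂ] E.E) := fun j => (w j).trans (E.kMinEquiv (i j))
  have hu : ∀ j m, 2 * m ≤ i j + 2 → ∀ x : Matrix (Fin m) (Fin m) X.E,
      matNorm (x.map (u j)) ≤ matNorm x := fun j m hm x =>
    (E.matNorm_kMinEquiv hm (x.map (w j))).trans_le (hw j m x)
  have hu' : ∀ j m, 2 * m ≤ i j + 2 → ∀ y : Matrix (Fin m) (Fin m) E.E,
      matNorm (y.map (u j).symm) ≤ (1 + 1 / ((j : ℝ) + 1)) * matNorm y := by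
    intro j m hm y
    refine (hw' j m (y.map (E.kMinEquiv (i j)).symm)).trans_eq ?_
    rw [← E.matNorm_kMinEquiv hm]
    congr 2
    ext1 r s
    exact (E.kMinEquiv (i j)).apply_symm_apply _
  obtain ⟨v, hv⟩ := exists_limit_equiv u
    (fun j x => by
      have := norm_le_of_matNorm_map_le (u := (u j : X.E →ₗ[ℂ] E.E)) (c := 1)
        (fun x => by rw [one_mul]; exact hu j 1 (by omega) x) x
      rwa [one_mul] at this)
    (fun j => norm_le_of_matNorm_map_le (u := ((u j).symm : E.E →ₗ[ℂ] X.E))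
      (hu' j 1 (by omega)))
  refine ⟨v, fun m => hv m ?_⟩
  filter_upwards [Filter.eventually_ge_atTop (2 * m)] with j hj
  have := hi j
  exact ⟨hu j m (by omega), hu' j m (by omega)⟩

/-- A cluster point `X` of the minimal structures inherits `d_SK ≤ 1` from them, and it is
completely isometric to `E`. -/
theorem OS.dSK_le_one_of_isCompact {n : ℕ} (hn : n ≠ 0) (E : FinDim.{u} n)
    (h : IsCompact (OS.isometricTo E)) : dSK E.E ≤ 1 := by
  have := E.nontrivial hn
  obtain ⟨X, -, φ, hφ, hlim⟩ := h.tendsto_subseq fun k => OS.kMin_mem_isometricTo E k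
  induction X using Quotient.inductionOn with | h X => ?_
  have := X.nontrivial hn
  have key : ∀ j : ℕ, ∃ i, j ≤ i ∧
      OperatorSpace.dcb X.E (E.kMin i).E < ENNReal.ofReal (1 + 1 / ((j : ℝ) + 1)) := by
    intro j
    obtain ⟨N, hN, hjN⟩ := ((Metric.tendsto_nhds.1 hlim _ (log_one_add_pos j)).and
      (Filter.eventually_ge_atTop j)).exists
    -- Reindexing by `φ N ≥ N ≥ j` couples the distortion `1 + 1/(j+1)` with an index at least `j`.
    refine ⟨φ N, hjN.trans (hφ.id_le N), FinDim.dcb_lt_of_dist_lt hn (by positivity) ?_⟩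
    rw [dist_comm]
    exact hN
  choose i hi hlt using key
  obtain ⟨v, hv⟩ := FinDim.exists_isCompleteIsometry_of_dcb_kMin_lt hn E X i hi hlt
  have hX : dSK X.E ≤ 1 := by
    have hε : Filter.Tendsto (fun j : ℕ => ENNReal.ofReal (1 + 1 / ((j : ℝ) + 1)))
        Filter.atTop (nhds (ENNReal.ofReal (1 + 0))) :=
      ENNReal.tendsto_ofReal (tendsto_one_div_add_atTop_nhds_zero_nat.const_add 1)
    rw [add_zero, ENNReal.ofReal_one] at hε
    -- `X` lies within `1 + 1/(j+1)` of a space with `d_SK ≤ 1`, for every `j`.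
    refine ge_of_tendsto' hε fun j => ?_
    have := (E.kMin (i j)).nontrivial hn
    calc dSK X.E ≤ OperatorSpace.dcb X.E (E.kMin (i j)).E * dSK (E.kMin (i j)).E :=
          dSK_le_mul (by rw [FinDim.finrank_eq, FinDim.finrank_eq])
      _ ≤ ENNReal.ofReal (1 + 1 / ((j : ℝ) + 1)) * 1 :=
          mul_le_mul' (hlt j).le (E.dSK_kMin _)
      _ = _ := mul_one _
  calc dSK E.E ≤ OperatorSpace.dcb E.E X.E * dSK X.E :=
        dSK_le_mul (by rw [FinDim.finrank_eq, FinDim.finrank_eq])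
    _ ≤ 1 * 1 := mul_le_mul' (dcb_le_one hv.symm) hX
    _ = 1 := mul_one _

end OperatorSpace

end

theorem corollary13 (n : ℕ) (E₀ : OperatorSpace.FinDim.{u} n)
    (hE₀ : 1 < OperatorSpace.dSK E₀.E) :
    IsClosed (OperatorSpace.OS.isometricTo E₀) ∧
      ¬ IsCompact (OperatorSpace.OS.isometricTo E₀) := by
  have hn : n ≠ 0 := by
    rintro rfl
    exact hE₀.not_ge E₀.dSK_dim_zero
  exact ⟨OperatorSpace.OS.isClosed_isometricTo hn E₀,
    fun h => hE₀.not_ge (OperatorSpace.OS.dSK_le_one_of_isCompact hn E₀ h)⟩
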